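/- Let $\theta\in[-\pi,\pi]$. For $n\ge 1$ and complex numbers $v_0,\dots,v_{n-1}$ let $\mathrm{Circ}(v_0,\dots,v_{n-1})$ be the $n\times n$ circulant matrix whose $(i,j)$ entry is $v_{(j-i)\bmod n}$, $0\le i,j\le n-1$. Let $D_n(\theta)=\mathrm{diag}(1,e^{\mathrm i\theta/n},e^{2\mathrm i\theta/n},\dots,e^{\mathrm i\theta(n-1)/n})$ and $\eta=\eta_n=e^{\mathrm i\pi/n}$. A non-commutative $*$-probability space is a pair $(\mathcal A,\varphi)$ of a unital complex $*$-algebra $\mathcal A$ and a linear functional $\varphi:\mathcal A\to\mathbb C$ with $\varphi(1)=1$. For a probability space $(\Omega,\mathbb P)$, regard $n\times n$ random matrices whose entries have finite moments of all orders as elements of the non-commutative $*$-probability space $(\mathcal M_n,\varphi_n)$, $\varphi_n=n^{-1}\mathbb E\,\mathrm{Tr}$. There exist a non-commutative $*$-probability space $(\mathcal A,\varphi)$ and elements $N,d(\theta)\in\mathcal A$, depending on $\theta$ only, such that (i) $N$ is a standard complex Gaussian variable: it is normal and not self-adjoint, and $\varphi(N^kN^{*l})=\mathbb E[Z^k\bar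 Z^l]$ for all integers $k,l\ge0$, where $Z=X+\mathrm iY$ with $X,Y$ independent real Gaussian variables of mean $0$ and variance $1/2$; (ii) the $*$-moments of $d(\theta)$ are those of $e^{\mathrm i\theta U}$ with $U$ uniform on $(0,1)$; (iii) for every sequence $(c_j)_{j\ge0}$ of independent (real or complex) random variables on some probability space with $\mathbb E c_j=0$, $\mathbb E|c_j|^2=1$ and $\sup_j\mathbb E|c_j|^k<\infty$ for every $k\ge 1$ (in particular for i.i.d. standard Gaussian $c_j$), put $C_n=\mathrm{Circ}(c_0,c_1,\dots,c_{n-1})$ and $\tilde C_n=\mathrm{Circ}(c_0,c_1\eta,\dots,c_{n-1}\eta^{n-1})$. Then both pairs $\{n^{-1/2}\tilde C_n,D_n(\theta)\}$ and $\{n^{-1/2}C_n,D_n(\theta)\}$ converge jointly in $*$-distribution to the same limit $\{N,d(\theta)\}$. That is, for every monomial $Q$ in two non-commuting indeterminates and their adjoints, $$\lim_{n\to\infty}\varphi_n\big(Q(n^{-1/2}\tilde C_n,D_n(\theta))\big)=\varphi\big(Q(N,d(\theta))\big)=\lim_{n\to\infty}\varphi_n\big(Q(n^{-1/2}C_n,D_n(\theta))\big).$$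 -/

import Mathlib

open MeasureTheory ProbabilityTheory Filter Topology

noncomputable section

namespace CirculantStarConv

/-! ### Noncommutative `*`-probability: words, moments, convergence -/

/-- The value of a `*`-monomial at a family `a` of elements of a `*`-monoid. A monomial in the
noncommuting letters `x i`, `(x i)^*` is a list of pairs `(i, b)`: the letter is `x i` if
`b = false` and `(x i)^*` if `b = true`. -/
def evalWord {ι A : Type*} [Monoid A] [Star A] (a : ι → A) (w : List (ι × Bool)) : A :=
  (w.map fun p => if p.2 then star (a p.1) else a p.1).prod

/-- Convergence in `*`-distribution of the families `a n` in `(A n, φ n)` to the family `b`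
in `(B, ψ)`: convergence of all joint `*`-moments. -/
def StarConverges {ι : Type*} {A : ℕ → Type*} {B : Type*}
    [∀ n, Ring (A n)] [∀ n, StarRing (A n)] [∀ n, Algebra ℂ (A n)]
    [Ring B] [StarRing B] [Algebra ℂ B]
    (φ : ∀ n, A n →ₗ[ℂ] ℂ) (a : ∀ n, ι → A n) (ψ : B →ₗ[ℂ] ℂ) (b : ι → B) : Prop :=
  ∀ w : List (ι × Bool),
    Tendsto (fun n => φ n (evalWord (a n) w)) atTop (𝓝 (ψ (evalWord b w)))

/-- The `*`-moments of `a` in `(A, φ)` are those of a complex random variable with law `μ`. -/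
def HasStarMomentsOf {A : Type*} [Ring A] [StarRing A] [Algebra ℂ A]
    (φ : A →ₗ[ℂ] ℂ) (a : A) (μ : Measure ℂ) : Prop :=
  ∀ w : List (Unit × Bool),
    φ (evalWord (fun _ => a) w) = ∫ z, evalWord (fun _ => z) w ∂μ

/-- The law of `X + iY`, with `X`, `Y` independent real Gaussians of mean `0`, variance `1/2`. -/
def stdComplexGaussian : Measure ℂ :=
  ((gaussianReal 0 (1 / 2)).prod (gaussianReal 0 (1 / 2))).map
    fun p : ℝ × ℝ => (p.1 : ℂ) + (p.2 : ℂ) * Complex.I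

/-- The law of `exp (iθU)`, with `U` uniform on `(0, 1)`. -/
def expUniformLaw (θ : ℝ) : Measure ℂ :=
  (volume.restrict (Set.Ioo (0 : ℝ) 1)).map
    fun u : ℝ => Complex.exp (((θ * u : ℝ) : ℂ) * Complex.I)

/-- A standard complex Gaussian variable of `(A, φ)`: a normal, non-self-adjoint element whose
moments `φ (a ^ k * (a^*) ^ l)` are those of the standard complex Gaussian law. -/
structure IsStdComplexGaussian {A : Type*} [Ring A] [StarRing A] [Algebra ℂ A]
    (φ : A →ₗ[ℂ] ℂ) (a : A) : Prop where
  normal : IsStarNormal a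
  not_selfAdjoint : ¬ IsSelfAdjoint a
  moments : ∀ k l : ℕ,
    φ (a ^ k * star a ^ l) = ∫ z, z ^ k * star z ^ l ∂stdComplexGaussian

/-! ### Random matrices with finite moments -/

section RandomMatrices

variable {Ω : Type*} [MeasurableSpace Ω]

lemma memLp_mul_of_all {P : Measure Ω} {f g : Ω → ℂ}
    (hf : ∀ k : ℕ, MemLp f k P) (hg : ∀ k : ℕ, MemLp g k P) (k : ℕ) :
    MemLp (fun ω => f ω * g ω) k P := by
  have h2 : ((2 * k : ℕ) : ENNReal)⁻¹ + ((2 * k : ℕ) : ENNReal)⁻¹ = (k : ENNReal)⁻¹ := by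
    rw [← two_mul]
    push_cast
    rw [ENNReal.mul_inv (Or.inl (by norm_num)) (Or.inl (by norm_num)), ← mul_assoc,
      ENNReal.mul_inv_cancel (by norm_num) (by norm_num), one_mul]
  have : ENNReal.HolderTriple ((2 * k : ℕ) : ENNReal) ((2 * k : ℕ) : ENNReal) (k : ENNReal) :=
    ⟨h2⟩
  exact (hg (2 * k)).mul' (hf (2 * k))

/-- The `*`-algebra of `n × n` random matrices on `(Ω, P)` all of whose entries have finite
moments of all orders. -/
def randMat (P : Measure Ω) [IsProbabilityMeasure P] (n : ℕ) :
    StarSubalgebra ℂ (Ω → Matrix (Fin n) (Fin n) ℂ) where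
  carrier := {X | ∀ (i j : Fin n) (k : ℕ), MemLp (fun ω => X ω i j) k P}
  mul_mem' := by
    intro X Y hX hY i j k
    simp only [Pi.mul_apply, Matrix.mul_apply]
    exact memLp_finsetSum _ fun l _ => memLp_mul_of_all (hX i l) (hY l j) k
  add_mem' := by
    intro X Y hX hY i j k
    exact (hX i j k).add (hY i j k)
  algebraMap_mem' := by
    intro r i j k
    exact memLp_const _
  star_mem' := by
    intro X hX i j k
    exact (hX j i k).star

/-- The state `n⁻¹ E Tr` on `randMat P n`. -/
def meanTrace (P : Measure Ω) [IsProbabilityMeasure P] (n : ℕ) : randMat P n →ₗ[ℂ] ℂ where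
  toFun X := (n : ℂ)⁻¹ * ∫ ω, (X.1 ω).trace ∂P
  map_add' := by
    intro X Y
    have hi : ∀ Z : randMat P n, Integrable (fun ω => (Z.1 ω).trace) P := fun Z =>
      integrable_finsetSum _ fun i _ => by
        have := Z.2 i i 1
        rw [Nat.cast_one] at this
        exact memLp_one_iff_integrable.1 this
    rw [← mul_add, ← integral_add (hi X) (hi Y)]
    simp [Matrix.trace_add]
  map_smul' := by
    intro r X
    have : ∀ ω, ((r • X).1 ω).trace = r * (X.1 ω).trace := fun ω => by
      simp [Matrix.trace_smul]
    simp only [this, integral_const_mul, RingHom.id_apply, smul_eq_mul]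
    ring

/-- `meanTrace` is unital in every positive dimension. -/
lemma meanTrace_one (P : Measure Ω) [IsProbabilityMeasure P] (n : ℕ) (hn : n ≠ 0) :
    meanTrace P n 1 = 1 := by
  simp [meanTrace, Matrix.trace_one, hn]

/-- A sequence of independent (real or complex) random variables with mean zero, unit variance,
and, for every order, uniformly bounded absolute moments of that order. -/
structure IsInputSequence (P : Measure Ω) (c : ℕ → Ω → ℂ) : Prop where
  measurable : ∀ j, Measurable (c j)
  indep : iIndepFun c P
  memLp : ∀ (j k : ℕ), MemLp (c j) k P
  mean : ∀ j, ∫ ω, c j ω ∂P = 0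
  variance : ∀ j, ∫ ω, ‖c j ω‖ ^ 2 ∂P = 1
  bounded : ∀ k : ℕ, ∃ B : ℝ, ∀ j, ∫ ω, ‖c j ω‖ ^ k ∂P ≤ B

/-- The circulant matrix with first row `v`: its `(i, j)` entry is `v ((j - i) mod n)`
(subtraction in `Fin n` is modulo `n`). -/
def circ {n : ℕ} (v : Fin n → ℂ) : Matrix (Fin n) (Fin n) ℂ :=
  Matrix.of fun i j => v (j - i)

/-- The root of unity `exp (iπ/n)`. -/
def twistRoot (n : ℕ) : ℂ := Complex.exp (((Real.pi / n : ℝ) : ℂ) * Complex.I)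

variable {P : Measure Ω} [IsProbabilityMeasure P] {c : ℕ → Ω → ℂ}

/-- The random circulant matrix `Circ (c₀, c₁, …, cₙ₋₁)`. -/
def circulantMat (hc : IsInputSequence P c) (n : ℕ) : randMat P n :=
  ⟨fun ω => circ fun k => c k ω, fun i j k => hc.memLp ((j - i : Fin n) : ℕ) k⟩

/-- The twisted random circulant matrix `Circ (c₀, c₁ η, …, cₙ₋₁ ηⁿ⁻¹)`, `η = exp (iπ/n)`. -/
def twistedCirculantMat (hc : IsInputSequence P c) (n : ℕ) : randMat P n :=
  ⟨fun ω => circ fun k => c k ω * twistRoot n ^ (k : ℕ),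
    fun i j k => (hc.memLp ((j - i : Fin n) : ℕ) k).mul_const _⟩

variable (P)

/-- The deterministic matrix `diag (1, e^{iθ/n}, …, e^{iθ(n-1)/n})`. -/
def diagMat (θ : ℝ) (n : ℕ) : randMat P n :=
  ⟨fun _ => Matrix.diagonal fun j : Fin n =>
      Complex.exp (((θ / n : ℝ) : ℂ) * Complex.I) ^ (j : ℕ),
    fun _ _ _ => memLp_const _⟩

end RandomMatrices

end CirculantStarConv

end

noncomputable section

namespace CirculantStarConv

/-! ### Moments of the standard complex Gaussian -/

/-! A `*`-word in a circulant matrix and a diagonal one is an alternating product of circulant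
factors and functions of `j / n` (`exists_altProd`). Its trace is a sum over closed walks on `Fin n`
with signed steps `k`, each weighted by entries `v (k s)` and by the functions at the visited sites
(`trace_altProd`). Whether the walk closes depends only on `k`.

In expectation, a value occurring once in `k` kills the term, so with `q` circulant letters at most
`q / 2` distinct steps matter. Tuples with fewer values are too few to survive the normalisation `n
^ (-1 - q / 2)`. If all values occur exactly twice but some pair carries equal signs, closing the
walk fixes twice that value, which costs a factor `n`. What remains are pairings of each starred
letter with an unstarred one: the walk then closes by itself and the moment is a product of `E|c|^2
= 1`. The error is of order `n ^ (-1/2)` (`norm_meanTrace_evalWord_sub_le`).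

For each pairing, the surviving sum over the starting point and the free steps is a Riemann sum. Its
integrand involves fractional parts of linear forms, hence is continuous almost everywhere
(`tendsto_pairingSum`). The limit `altLimit` depends on the word and `θ` only. The twist multiplies
the inputs by unimodular constants, so it gives the same limit.

The limit space consists of sequences of random matrices in one fixed model, with the limiting trace
as functional. Circulants commute, so `N` is normal there. Without diagonal letters the limit counts
bijections between starred and unstarred letters, which are the Gaussian moments. -/

lemma integral_exp_int_mul_I (m : ℤ) :
    ∫ t in Set.Ioo (-Real.pi) Real.pi, Complex.exp ((m : ℂ) * Complex.I * t) =
      if m = 0 then (2 * Real.pi : ℂ) else 0 := by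
  rw [← integral_Ioc_eq_integral_Ioo,
    ← intervalIntegral.integral_of_le (by linarith [Real.pi_pos])]
  split_ifs with hm
  · subst hm
    simp
    ring
  · rw [integral_exp_mul_complex (by simp [hm])]
    have : Complex.exp ((m : ℂ) * Complex.I * (Real.pi : ℝ)) =
        Complex.exp ((m : ℂ) * Complex.I * ((-Real.pi : ℝ) : ℂ)) := by
      rw [Complex.exp_eq_exp_iff_exists_int]
      exact ⟨m, by push_cast; ring⟩
    rw [this, sub_self, zero_div]

lemma integral_pow_mul_exp_neg_sq (k : ℕ) :
    ∫ r in Set.Ioi (0 : ℝ), r ^ (2 * k + 1) * Real.exp (-r ^ 2) = (k.factorial : ℝ) / 2 := by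
  have h := integral_rpow_mul_exp_neg_rpow (p := 2) (q := ((2 * k + 1 : ℕ) : ℝ)) (by norm_num)
    (lt_of_lt_of_le (by norm_num) (Nat.cast_nonneg _))
  simp only [Real.rpow_natCast, Real.rpow_ofNat] at h
  rw [h]
  have : (((2 * k + 1 : ℕ) : ℝ) + 1) / 2 = (k : ℝ) + 1 := by push_cast; ring
  rw [this, Real.Gamma_nat_eq_factorial]
  ring

lemma integral_stdComplexGaussian {g : ℂ → ℂ} (hg : Continuous g) :
    ∫ z, g z ∂stdComplexGaussian =
      ∫ z : ℂ, ((Real.pi⁻¹ * Real.exp (-‖z‖ ^ 2) : ℝ) : ℂ) * g z := by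
  have hm : Measurable fun p : ℝ × ℝ => (p.1 : ℂ) + (p.2 : ℂ) * Complex.I := by fun_prop
  have hv : (1 / 2 : NNReal) ≠ 0 := by norm_num
  rw [stdComplexGaussian, integral_map hm.aemeasurable hg.aestronglyMeasurable,
    gaussianReal_of_var_ne_zero _ hv,
    prod_withDensity (measurable_gaussianPDF _ _) (measurable_gaussianPDF _ _),
    integral_withDensity_eq_integral_toReal_smul (by fun_prop)
      (ae_of_all _ fun p => ENNReal.mul_lt_top gaussianPDF_lt_top gaussianPDF_lt_top),
    ← (Complex.volume_preserving_equiv_real_prod.symm).integral_comp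
      Complex.measurableEquivRealProd.symm.measurableEmbedding]
  refine integral_congr_ae (ae_of_all _ fun p => ?_)
  have hz : Complex.measurableEquivRealProd.symm p = (p.1 : ℂ) + (p.2 : ℂ) * Complex.I := by
    rw [Complex.measurableEquivRealProd_symm_apply]
    apply Complex.ext <;> simp
  have hn : ‖(p.1 : ℂ) + (p.2 : ℂ) * Complex.I‖ ^ 2 = p.1 ^ 2 + p.2 ^ 2 := by
    rw [← Complex.normSq_eq_norm_sq, Complex.normSq_add_mul_I]
  simp only [hz, hn, Complex.real_smul, ENNReal.toReal_mul, toReal_gaussianPDF, gaussianPDFReal]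
  congr 2
  have h2 : (2 * Real.pi * ((1 / 2 : NNReal) : ℝ)) = Real.pi := by push_cast; ring
  have h3 : (2 * ((1 / 2 : NNReal) : ℝ)) = 1 := by push_cast; ring
  rw [h2, h3, mul_mul_mul_comm, ← Real.exp_add, ← mul_inv, Real.mul_self_sqrt Real.pi_pos.le]
  congr 2
  ring

/-- In polar coordinates the integral factors: the angular part vanishes unless `k = l`, and the
radial part is a Gamma integral. -/
theorem stdComplexGaussian_moments (k l : ℕ) :
    ∫ z, z ^ k * star z ^ l ∂stdComplexGaussian = if k = l then (k.factorial : ℂ) else 0 := by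
  rw [integral_stdComplexGaussian (by fun_prop), ← Complex.integral_comp_polarCoord_symm,
    polarCoord_target]
  have hint : ∀ p : ℝ × ℝ, p.1 • (((Real.pi⁻¹ *
      Real.exp (-‖Complex.polarCoord.symm p‖ ^ 2) : ℝ) : ℂ) *
        (Complex.polarCoord.symm p ^ k * star (Complex.polarCoord.symm p) ^ l)) =
      ((Real.pi⁻¹ * (p.1 ^ (k + l + 1) * Real.exp (-p.1 ^ 2)) : ℝ) : ℂ) *
        Complex.exp ((((k : ℤ) - l : ℤ) : ℂ) * Complex.I * p.2) := by
    intro p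
    have hp : Complex.polarCoord.symm p = p.1 * Complex.exp (p.2 * Complex.I) := by
      rw [Complex.polarCoord_symm_apply, Complex.exp_mul_I]
      push_cast
      rfl
    have he : Complex.exp ((((k : ℤ) - l : ℤ) : ℂ) * Complex.I * p.2) =
        Complex.exp (p.2 * Complex.I) ^ k * Complex.exp (-(p.2 * Complex.I)) ^ l := by
      rw [← Complex.exp_nat_mul, ← Complex.exp_nat_mul, ← Complex.exp_add]
      congr 1
      push_cast
      ring
    have hs : star (Complex.exp (p.2 * Complex.I)) = Complex.exp (-(p.2 * Complex.I)) := by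
      rw [Complex.star_def, ← Complex.exp_conj]
      simp
    have hr : star (p.1 : ℂ) = p.1 := by simp
    rw [Complex.norm_polarCoord_symm, sq_abs, hp, star_mul', hs, he, hr, Complex.real_smul]
    push_cast
    ring
  simp only [hint]
  rw [Measure.volume_eq_prod, setIntegral_prod_mul
    (fun r : ℝ => ((Real.pi⁻¹ * (r ^ (k + l + 1) * Real.exp (-r ^ 2)) : ℝ) : ℂ))
    (fun t : ℝ => Complex.exp ((((k : ℤ) - l : ℤ) : ℂ) * Complex.I * t)),
    integral_exp_int_mul_I, integral_complex_ofReal, integral_const_mul]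
  by_cases hkl : k = l
  · subst hkl
    rw [← two_mul, integral_pow_mul_exp_neg_sq]
    simp
    field_simp
  · have : (k : ℤ) - l ≠ 0 := by omega
    simp [this, hkl]

/-! ### Riemann sums over a cube -/

section Riemann

variable {ι : Type*}

/-- The half-open unit cube. -/
def unitCube (ι : Type*) : Set (ι → ℝ) := Set.univ.pi fun _ => Set.Ico (0 : ℝ) 1

/-- The coordinatewise rounding down to a multiple of `1 / n`. -/
def gridRound (n : ℕ) (u : ι → ℝ) : ι → ℝ := fun i => (⌊n * u i⌋₊ : ℝ) / n

lemma measurableSet_unitCube [Finite ι] : MeasurableSet (unitCube ι) :=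
  MeasurableSet.univ_pi fun _ => measurableSet_Ico

lemma volume_unitCube [Fintype ι] : volume (unitCube ι) = 1 := by
  rw [unitCube, Real.volume_pi_Ico]
  simp

/-- The cube is cut into boxes of side `1 / n`, on each of which `gridRound n` is constant. -/
lemma integral_gridRound [Fintype ι] [DecidableEq ι] (F : (ι → ℝ) → ℂ) {n : ℕ} (hn : 0 < n) :
    ∫ u in unitCube ι, F (gridRound n u) =
      ((n : ℂ) ^ Fintype.card ι)⁻¹ * ∑ y : ι → Fin n, F fun i => ((y i : ℕ) : ℝ) / n := by
  have hn' : (0 : ℝ) < n := Nat.cast_pos.2 hn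
  let box : (ι → Fin n) → Set (ι → ℝ) := fun y =>
    Set.univ.pi fun i => Set.Ico (((y i : ℕ) : ℝ) / n) ((((y i : ℕ) : ℝ) + 1) / n)
  have hbox : ∀ y u, u ∈ box y → ∀ i, ⌊n * u i⌋₊ = (y i : ℕ) := by
    intro y u hu i
    obtain ⟨h1, h2⟩ := hu i (Set.mem_univ i)
    rw [div_le_iff₀ hn'] at h1
    rw [lt_div_iff₀ hn'] at h2
    rw [Nat.floor_eq_iff (le_trans (Nat.cast_nonneg _) (by linarith [mul_comm (u i) (n : ℝ)]))]
    constructor <;> linarith [mul_comm (u i) (n : ℝ)]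
  have hcube : unitCube ι = ⋃ y, box y := by
    ext u
    simp only [Set.mem_iUnion]
    constructor
    · intro hu
      have hlt : ∀ i, ⌊n * u i⌋₊ < n := fun i => by
        obtain ⟨h1, h2⟩ := hu i (Set.mem_univ i)
        rw [Nat.floor_lt (by positivity)]
        nlinarith
      refine ⟨fun i => ⟨⌊n * u i⌋₊, hlt i⟩, fun i _ => ?_⟩
      obtain ⟨h1, h2⟩ := hu i (Set.mem_univ i)
      have h3 := Nat.floor_le (show 0 ≤ (n : ℝ) * u i by positivity)
      have h4 := Nat.lt_floor_add_one ((n : ℝ) * u i)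
      refine ⟨?_, ?_⟩
      · rw [div_le_iff₀ hn']; linarith [mul_comm (u i) (n : ℝ)]
      · rw [lt_div_iff₀ hn']; linarith [mul_comm (u i) (n : ℝ)]
    · rintro ⟨y, hy⟩ i -
      obtain ⟨h1, h2⟩ := hy i (Set.mem_univ i)
      refine ⟨le_trans (by positivity) h1, lt_of_lt_of_le h2 ?_⟩
      rw [div_le_one hn']
      exact_mod_cast (y i).2
  have hmeas : ∀ y, MeasurableSet (box y) := fun y =>
    MeasurableSet.univ_pi fun _ => measurableSet_Ico
  have hdisj : Pairwise (Function.onFun Disjoint box) := by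
    intro y z hyz
    rw [Function.onFun, Set.disjoint_left]
    intro u hy hz
    exact hyz (funext fun i => Fin.ext ((hbox y u hy i).symm.trans (hbox z u hz i)))
  have hval : ∀ y, ∀ u ∈ box y,
      F (gridRound n u) = F fun i => ((y i : ℕ) : ℝ) / n := by
    intro y u hu
    congr 1
    funext i
    simp [gridRound, hbox y u hu i]
  have hvol : ∀ y, volume.real (box y) = ((n : ℝ) ^ Fintype.card ι)⁻¹ := by
    intro y
    rw [measureReal_def, Real.volume_pi_Ico_toReal]
    · have : ∀ i, (((y i : ℕ) : ℝ) + 1) / n - ((y i : ℕ) : ℝ) / n = (n : ℝ)⁻¹ := fun i => by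
        field_simp
        ring
      simp [this]
    · intro i
      exact div_le_div_of_nonneg_right (by linarith) hn'.le
  have hfin : ∀ y, volume (box y) ≠ ⊤ := fun y => by
    rw [Real.volume_pi_Ico]
    exact (ENNReal.prod_lt_top fun _ _ => ENNReal.ofReal_lt_top).ne
  rw [hcube, integral_iUnion_fintype hmeas hdisj, Finset.mul_sum]
  · refine Finset.sum_congr rfl fun y _ => ?_
    rw [setIntegral_congr_fun (hmeas y) (hval y), setIntegral_const, hvol, Complex.real_smul]
    push_cast
    rfl
  · intro y
    exact IntegrableOn.congr_fun (integrableOn_const (hfin y)) (fun u hu => (hval y u hu).symm)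
      (hmeas y)

lemma tendsto_gridRound {u : ι → ℝ} (hu : u ∈ unitCube ι) :
    Tendsto (fun n : ℕ => gridRound n u) atTop (𝓝 u) := by
  rw [tendsto_pi_nhds]
  intro i
  have h := (tendsto_nat_floor_mul_div_atTop (hu i (Set.mem_univ i)).1).comp
    (tendsto_natCast_atTop_atTop (R := ℝ))
  simpa [gridRound, Function.comp_def, mul_comm] using h

lemma measurable_gridRound (n : ℕ) : Measurable (gridRound n : (ι → ℝ) → ι → ℝ) := by
  unfold gridRound
  fun_prop

/-- Once the Riemann sum is the integral of `F ∘ gridRound n`, dominated convergence applies, and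
continuity of `F` is needed only almost everywhere. -/
theorem tendsto_riemannSum [Fintype ι] [DecidableEq ι] {F : (ι → ℝ) → ℂ} (hF : Measurable F) {B : ℝ}
    (hB : ∀ u, ‖F u‖ ≤ B) (hc : ∀ᵐ u, ContinuousAt F u) :
    Tendsto (fun n : ℕ => ((n : ℂ) ^ Fintype.card ι)⁻¹ *
        ∑ y : ι → Fin n, F fun i => ((y i : ℕ) : ℝ) / n) atTop
      (𝓝 (∫ u in unitCube ι, F u)) := by
  have : IsFiniteMeasure (volume.restrict (unitCube ι)) :=
    ⟨by rw [Measure.restrict_apply_univ, volume_unitCube]; exact ENNReal.one_lt_top⟩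
  have h : Tendsto (fun n : ℕ => ∫ u in unitCube ι, F (gridRound n u)) atTop
      (𝓝 (∫ u in unitCube ι, F u)) := by
    refine tendsto_integral_of_dominated_convergence (fun _ => B)
      (fun n => (hF.comp (measurable_gridRound n)).aestronglyMeasurable)
      (integrable_const B) (fun n => ae_of_all _ fun u => hB _) ?_
    filter_upwards [ae_restrict_of_ae hc, ae_restrict_mem measurableSet_unitCube] with u hu hmem
    exact hu.tendsto.comp (tendsto_gridRound hmem)
  refine h.congr' ?_
  filter_upwards [eventually_gt_atTop 0] with n hn
  exact integral_gridRound F hn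

end Riemann

/-! ### Counting index tuples -/

/-- `x` or `-x` according to a sign. -/
def signed {G : Type*} [Neg G] (b : Bool) (x : G) : G := if b then -x else x

section Counting

variable {ι : Type*} [Fintype ι] [DecidableEq ι] {n : ℕ} [NeZero n]

/-- A tuple with at most `r` values factors through `Fin r`. The base `r + 1` instead of `r` is
never zero, so the exponent can later be enlarged freely. -/
lemma card_image_le_count (r : ℕ) :
    (Finset.univ.filter fun k : ι → Fin n => (Finset.univ.image k).card ≤ r).card ≤
      (r + 1) ^ Fintype.card ι * n ^ r := by
  classical
  have hsub : (Finset.univ.filter fun k : ι → Fin n => (Finset.univ.image k).card ≤ r) ⊆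
      Finset.univ.image fun p : (ι → Fin r) × (Fin r → Fin n) => p.2 ∘ p.1 := by
    intro k hk
    rw [Finset.mem_filter] at hk
    obtain ⟨e⟩ : Nonempty ((Finset.univ.image k : Finset (Fin n)) ↪ Fin r) :=
      Function.Embedding.nonempty_of_card_le
        (by rw [Fintype.card_coe, Fintype.card_fin]; exact hk.2)
    rw [Finset.mem_image]
    -- Labels in `Fin r` not used by `e` receive the irrelevant value `0`.
    refine ⟨⟨fun i => e ⟨k i, Finset.mem_image_of_mem _ (Finset.mem_univ _)⟩,
      Function.extend e Subtype.val fun _ => 0⟩, Finset.mem_univ _, ?_⟩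
    funext i
    simp only [Function.comp_apply]
    rw [e.injective.extend_apply]
  refine (Finset.card_le_card hsub).trans (Finset.card_image_le.trans ?_)
  rw [Finset.card_univ, Fintype.card_prod, Fintype.card_fun, Fintype.card_fun, Fintype.card_fin,
    Fintype.card_fin]
  gcongr
  omega

omit [NeZero n] in
-- Doubling modulo `n` is injective on each half of the range: it wraps around never on the lower
-- half and exactly once on the upper half.
lemma eq_of_add_self_eq {x y : Fin n} (h : x + x = y + y) (hb : n ≤ 2 * x.val ↔ n ≤ 2 * y.val) :
    x = y := by
  have h' := congrArg Fin.val h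
  rw [Fin.val_add, Fin.val_add] at h'
  have hx := x.2
  have hy := y.2
  apply Fin.ext
  by_cases hc : n ≤ 2 * x.val
  · have hc' := hb.1 hc
    rw [Nat.mod_eq_sub_mod (by omega), Nat.mod_eq_sub_mod (a := y.val + y.val) (by omega),
      Nat.mod_eq_of_lt (by omega), Nat.mod_eq_of_lt (by omega)] at h'
    omega
  · have hc' := fun h => hc (hb.2 h)
    rw [Nat.mod_eq_of_lt (by omega), Nat.mod_eq_of_lt (by omega)] at h'
    omega

/-- The tuples with a full fibre `{a, b}` of equal signs whose signed sum vanishes. -/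
def unbalancedTuples (n : ℕ) [NeZero n] (ε : ι → Bool) (a b : ι) (r : ℕ) : Finset (ι → Fin n) :=
  Finset.univ.filter fun k => k a = k b ∧ (∀ i, k i = k a → i = a ∨ i = b) ∧
    (Finset.univ.image k).card ≤ r + 1 ∧ ∑ i, signed (ε i) (k i) = 0

/-- Equal signs make the pair contribute `± 2 k a`, so the vanishing sum determines `k a + k a` from
the other entries, and one bit then recovers `k a`. The other entries avoid the value `k a`, hence
take at most `r` values. -/
lemma card_unbalancedTuples_le {ε : ι → Bool} {a b : ι} (hab : a ≠ b) (hε : ε a = ε b) (r : ℕ) :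
    (unbalancedTuples n ε a b r).card ≤ 2 * ((r + 1) ^ Fintype.card ι * n ^ r) := by
  classical
  let J := {i : ι // i ≠ a ∧ i ≠ b}
  let T : Finset (J → Fin n) := Finset.univ.filter fun k => (Finset.univ.image k).card ≤ r
  have hT : T.card ≤ (r + 1) ^ Fintype.card ι * n ^ r := by
    refine (card_image_le_count r).trans ?_
    gcongr
    · omega
    · exact Fintype.card_subtype_le _
  let Ψ : (ι → Fin n) → (J → Fin n) × Bool :=
    fun k => (fun j => k j.1, decide (n ≤ 2 * (k a).val))
  have hmaps : ∀ k ∈ unbalancedTuples n ε a b r, Ψ k ∈ T ×ˢ (Finset.univ : Finset Bool) := by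
    intro k hk
    obtain ⟨-, -, h2, h3, -⟩ := Finset.mem_filter.1 hk
    rw [Finset.mem_product]
    refine ⟨Finset.mem_filter.2 ⟨Finset.mem_univ _, ?_⟩, Finset.mem_univ _⟩
    have hsub : (Finset.univ.image fun j : J => k j.1) ⊆ (Finset.univ.image k).erase (k a) := by
      intro v hv
      obtain ⟨j, -, rfl⟩ := Finset.mem_image.1 hv
      refine Finset.mem_erase.2 ⟨fun h => ?_, Finset.mem_image_of_mem _ (Finset.mem_univ _)⟩
      rcases h2 _ h with h | h
      · exact j.2.1 h
      · exact j.2.2 h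
    have := Finset.card_le_card hsub
    rw [Finset.card_erase_of_mem (Finset.mem_image_of_mem _ (Finset.mem_univ _))] at this
    change (Finset.univ.image fun j : J => k j.1).card ≤ r
    omega
  have hinj : Set.InjOn Ψ (unbalancedTuples n ε a b r) := by
    intro k hk k' hk' h
    obtain ⟨-, h1, -, -, h4⟩ := Finset.mem_filter.1 (Finset.mem_coe.1 hk)
    obtain ⟨-, h1', -, -, h4'⟩ := Finset.mem_filter.1 (Finset.mem_coe.1 hk')
    obtain ⟨hr, hbit⟩ := Prod.mk.inj h
    have hoff : ∀ i, i ≠ a → i ≠ b → k i = k' i := fun i hia hib => congrFun hr ⟨i, hia, hib⟩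
    have hsplit : ∀ f : ι → Fin n, f a = f b → ∑ i, signed (ε i) (f i) =
        signed (ε a) (f a) + signed (ε a) (f a) +
          ∑ i ∈ (Finset.univ.erase a).erase b, signed (ε i) (f i) := by
      intro f hf
      rw [← Finset.add_sum_erase _ _ (Finset.mem_univ a), ← Finset.add_sum_erase _ _
        (Finset.mem_erase.2 ⟨hab.symm, Finset.mem_univ b⟩), ← hε, ← hf, add_assoc]
    rw [hsplit k h1] at h4
    rw [hsplit k' h1'] at h4'
    have hrest : ∑ i ∈ (Finset.univ.erase a).erase b, signed (ε i) (k i) =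
        ∑ i ∈ (Finset.univ.erase a).erase b, signed (ε i) (k' i) := by
      refine Finset.sum_congr rfl fun i hi => ?_
      rw [Finset.mem_erase, Finset.mem_erase] at hi
      rw [hoff i hi.2.1 hi.1]
    rw [hrest] at h4
    have hdouble := add_right_cancel (h4.trans h4'.symm)
    have ha : k a = k' a := by
      refine eq_of_add_self_eq ?_ (by simpa using hbit)
      unfold signed at hdouble
      split_ifs at hdouble
      · rwa [← neg_add, ← neg_add, neg_inj] at hdouble
      · exact hdouble
    funext i
    by_cases hia : i = a
    · rw [hia, ha]
    by_cases hib : i = b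
    · rw [hib, ← h1, ← h1', ha]
    exact hoff i hia hib
  refine (Finset.card_le_card_of_injOn Ψ hmaps hinj).trans ?_
  rw [Finset.card_product, Finset.card_univ, Fintype.card_bool]
  omega

end Counting

/-! ### Tuples with repeated values, and sign-reversing pairings -/

section Pairings

variable {ι κ : Type*} [Fintype ι] [DecidableEq κ]

lemma two_mul_card_image_le {k : ι → κ} (h : ∀ i, ∃ j, j ≠ i ∧ k j = k i) :
    2 * (Finset.univ.image k).card ≤ Fintype.card ι := by
  rw [← Finset.card_univ, Finset.card_eq_sum_card_image k Finset.univ, mul_comm, ← smul_eq_mul,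
    ← Finset.sum_const]
  refine Finset.sum_le_sum fun v hv => ?_
  obtain ⟨i, -, rfl⟩ := Finset.mem_image.1 hv
  obtain ⟨j, hj, hk⟩ := h i
  refine Finset.one_lt_card.2 ⟨i, by simp, j, by simp [hk], hj.symm⟩

/-- All fibres have at least two elements, so a fibre with three would push the total size beyond
twice the number of values. -/
lemma existsUnique_partner {k : ι → κ} (h : ∀ i, ∃ j, j ≠ i ∧ k j = k i)
    (hc : Fintype.card ι ≤ 2 * (Finset.univ.image k).card) (i : ι) :
    ∃! j, j ≠ i ∧ k j = k i := by
  obtain ⟨j, hj, hk⟩ := h i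
  refine ⟨j, ⟨hj, hk⟩, fun j' hj' => ?_⟩
  by_contra hne
  refine absurd hc (not_le.2 ?_)
  rw [← Finset.card_univ, Finset.card_eq_sum_card_image k Finset.univ, mul_comm, ← smul_eq_mul,
    ← Finset.sum_const]
  refine Finset.sum_lt_sum (fun v hv => ?_)
    ⟨k i, Finset.mem_image_of_mem _ (Finset.mem_univ _), ?_⟩
  · obtain ⟨i, -, rfl⟩ := Finset.mem_image.1 hv
    obtain ⟨j, hj, hk⟩ := h i
    exact Finset.one_lt_card.2 ⟨i, by simp, j, by simp [hk], hj.symm⟩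
  · exact Finset.two_lt_card.2 ⟨i, by simp, j, by simp [hk], j', by simp [hj'.2], hj.symm,
      hj'.1.symm, fun h => hne h.symm⟩

/-- The pairings of the positions of sign `false` with the positions of sign `true`. -/
abbrev Pairing (ε : ι → Bool) := {i // ε i = false} ≃ {i // ε i = true}

/-- The tuple `k` takes equal values on paired positions. -/
def Matched {ε : ι → Bool} (τ : Pairing ε) (k : ι → κ) : Prop := ∀ h, k (τ h).1 = k h.1

instance {ε : ι → Bool} (τ : Pairing ε) (k : ι → κ) : Decidable (Matched τ k) :=
  inferInstanceAs (Decidable (∀ h, k (τ h).1 = k h.1))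

omit [Fintype ι] [DecidableEq κ] in
lemma Matched.exists_partner {ε : ι → Bool} {τ : Pairing ε} {k : ι → κ} (h : Matched τ k)
    (i : ι) : ∃ j, j ≠ i ∧ k j = k i ∧ ε j ≠ ε i := by
  rcases hi : ε i with _ | _
  · refine ⟨(τ ⟨i, hi⟩).1, fun e => ?_, h ⟨i, hi⟩, ?_⟩
    · have := (τ ⟨i, hi⟩).2
      rw [e, hi] at this
      cases this
    · rw [(τ ⟨i, hi⟩).2]
      simp
  · have h' := h (τ.symm ⟨i, hi⟩)
    rw [τ.apply_symm_apply] at h'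
    refine ⟨(τ.symm ⟨i, hi⟩).1, fun e => ?_, h'.symm, ?_⟩
    · have := (τ.symm ⟨i, hi⟩).2
      rw [e, hi] at this
      cases this
    · rw [(τ.symm ⟨i, hi⟩).2]
      simp

lemma sum_eq_sum_signs {M : Type*} [AddCommMonoid M] (ε : ι → Bool) (g : ι → M) :
    ∑ i, g i = ∑ h : {i // ε i = false}, g h.1 + ∑ h : {i // ε i = true}, g h.1 := by
  rw [← Finset.sum_filter_add_sum_filter_not Finset.univ (fun i => ε i = false) g,
    Finset.sum_subtype (Finset.univ.filter fun i => ε i = false) (p := fun i => ε i = false)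
      (by simp),
    Finset.sum_subtype (Finset.univ.filter fun i => ¬ ε i = false) (p := fun i => ε i = true)
      (by simp)]

lemma Matched.sum_signed {G : Type*} [AddCommGroup G] {ε : ι → Bool} {τ : Pairing ε} {k : ι → G}
    (h : Matched τ k) : ∑ i, signed (ε i) (k i) = 0 := by
  rw [sum_eq_sum_signs ε]
  have h1 : ∑ h : {i // ε i = false}, signed (ε h.1) (k h.1) =
      ∑ h : {i // ε i = false}, k h.1 :=
    Finset.sum_congr rfl fun i _ => by simp [signed, i.2]
  have h2 : ∑ h : {i // ε i = true}, signed (ε h.1) (k h.1) =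
      ∑ h : {i // ε i = false}, -k h.1 := by
    rw [← τ.sum_comp]
    refine Finset.sum_congr rfl fun i _ => ?_
    rw [← h i]
    simp [signed, (τ i).2]
  rw [h1, h2, Finset.sum_neg_distrib, add_neg_cancel]

/-- The partner map is a sign-reversing involution, and its restriction is the only pairing
compatible with the fibres. -/
lemma card_matched_eq_one [DecidableEq ι] {ε : ι → Bool} {k : ι → κ} (h : ∀ i, ∃! j, j ≠ i ∧ k j = k i)
    (hε : ∀ i j, j ≠ i → k j = k i → ε j ≠ ε i) :
    (Finset.univ.filter fun τ : Pairing ε => Matched τ k).card = 1 := by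
  choose g hg hu using h
  have hgε : ∀ i, ε (g i) = !ε i := fun i => by
    have := hε i (g i) (hg i).1 (hg i).2
    revert this
    cases ε (g i) <;> cases ε i <;> simp
  have hgg : ∀ i, g (g i) = i := fun i =>
    (hu (g i) i ⟨(hg i).1.symm, (hg i).2.symm⟩).symm
  rw [Finset.card_eq_one]
  refine ⟨⟨fun i => ⟨g i.1, by rw [hgε, i.2]; rfl⟩, fun i => ⟨g i.1, by rw [hgε, i.2]; rfl⟩,
    fun i => Subtype.ext (hgg i.1), fun i => Subtype.ext (hgg i.1)⟩, ?_⟩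
  ext τ
  simp only [Finset.mem_filter, Finset.mem_univ, true_and, Finset.mem_singleton]
  constructor
  · intro hm
    ext i
    refine hu i.1 _ ⟨fun e => ?_, hm i⟩
    have := (τ i).2
    rw [e, i.2] at this
    cases this
  · rintro rfl i
    exact (hg i.1).2

end Pairings

/-! ### Mixed moments of the input sequence -/

/-- `z` or its conjugate. -/
def starIf {R : Type*} [Star R] (b : Bool) (z : R) : R := if b then star z else z

lemma norm_starIf (b : Bool) (z : ℂ) : ‖starIf b z‖ = ‖z‖ := by
  unfold starIf
  split_ifs <;> simp

lemma continuous_starIf (b : Bool) : Continuous (starIf b : ℂ → ℂ) := by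
  unfold starIf
  cases b
  · exact continuous_id
  · exact continuous_star

section Moments

variable {Ω : Type*} [MeasurableSpace Ω] {P : Measure Ω} {c : ℕ → Ω → ℂ}
variable {ι : Type*} [Fintype ι] {n : ℕ}

/-- The mixed moment of the inputs along the tuple `k`. -/
def tupleMoment (P : Measure Ω) (c : ℕ → Ω → ℂ) (ε : ι → Bool) (k : ι → Fin n) : ℂ :=
  ∫ ω, ∏ i, starIf (ε i) (c (k i) ω) ∂P

lemma IsInputSequence.integrable_norm_pow (hc : IsInputSequence P c) (j m : ℕ) :
    Integrable (fun ω => ‖c j ω‖ ^ m) P := by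
  have := hc.indep.isProbabilityMeasure
  exact (hc.memLp j m).integrable_norm_pow'

/-- The largest factor dominates the product, so moments of a single input suffice. The summand `1`
covers the empty product. -/
lemma norm_prod_le_one_add_sum_pow (ε : ι → Bool) (z : ι → ℂ) :
    ‖∏ i, starIf (ε i) (z i)‖ ≤ 1 + ∑ i, ‖z i‖ ^ Fintype.card ι := by
  rw [norm_prod]
  simp only [norm_starIf]
  rcases isEmpty_or_nonempty ι with h | h
  · simp
  · obtain ⟨m, hm⟩ := Finite.exists_max fun i => ‖z i‖
    calc ∏ i, ‖z i‖ ≤ ∏ _i : ι, ‖z m‖ :=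
          Finset.prod_le_prod (fun _ _ => norm_nonneg _) fun i _ => hm i
      _ = ‖z m‖ ^ Fintype.card ι := by rw [Finset.prod_const, Finset.card_univ]
      _ ≤ ∑ i, ‖z i‖ ^ Fintype.card ι :=
          Finset.single_le_sum (f := fun i => ‖z i‖ ^ Fintype.card ι)
            (fun i _ => by positivity) (Finset.mem_univ m)
      _ ≤ _ := by linarith

lemma IsInputSequence.measurable_prod (hc : IsInputSequence P c) (ε : ι → Bool)
    (k : ι → Fin n) : Measurable fun ω => ∏ i, starIf (ε i) (c (k i) ω) :=
  Finset.measurable_fun_prod _ fun i _ =>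
    (continuous_starIf (ε i)).measurable.comp (hc.measurable _)

lemma IsInputSequence.integrable_bound (hc : IsInputSequence P c) (k : ι → Fin n) (m : ℕ) :
    Integrable (fun ω => 1 + ∑ i, ‖c (k i) ω‖ ^ m) P := by
  have := hc.indep.isProbabilityMeasure
  exact (integrable_const 1).add (integrable_finsetSum _ fun i _ => hc.integrable_norm_pow _ _)

lemma IsInputSequence.integrable_prod (hc : IsInputSequence P c) (ε : ι → Bool)
    (k : ι → Fin n) : Integrable (fun ω => ∏ i, starIf (ε i) (c (k i) ω)) P :=
  (hc.integrable_bound k (Fintype.card ι)).mono' (hc.measurable_prod ε k).aestronglyMeasurable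
    (ae_of_all _ fun _ => norm_prod_le_one_add_sum_pow ε _)

lemma IsInputSequence.norm_tupleMoment_le (hc : IsInputSequence P c) {B : ℝ}
    (hB : ∀ j, ∫ ω, ‖c j ω‖ ^ Fintype.card ι ∂P ≤ B) (ε : ι → Bool) (k : ι → Fin n) :
    ‖tupleMoment P c ε k‖ ≤ 1 + Fintype.card ι * B := by
  have := hc.indep.isProbabilityMeasure
  refine (norm_integral_le_of_norm_le (hc.integrable_bound k (Fintype.card ι))
    (ae_of_all _ fun _ => norm_prod_le_one_add_sum_pow ε _)).trans ?_
  rw [integral_add (integrable_const 1)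
    (integrable_finsetSum _ fun i _ => hc.integrable_norm_pow _ _),
    integral_finsetSum _ fun i _ => hc.integrable_norm_pow _ _]
  have : ∑ i, ∫ ω, ‖c (k i) ω‖ ^ Fintype.card ι ∂P ≤ ∑ _i : ι, B :=
    Finset.sum_le_sum fun i _ => hB _
  simpa using this

lemma IsInputSequence.tupleMoment_eq_prod (hc : IsInputSequence P c) (ε : ι → Bool)
    (k : ι → Fin n) :
    tupleMoment P c ε k =
      ∏ v, ∫ ω, ∏ i with k i = v, starIf (ε i) (c v ω) ∂P := by
  have hind : iIndepFun (fun v : Fin n => c v) P := hc.indep.precomp Fin.val_injective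
  have hcont : ∀ v : Fin n, Continuous fun z : ℂ => ∏ i with k i = v, starIf (ε i) z :=
    fun v => continuous_finsetProd _ fun i _ => continuous_starIf (ε i)
  rw [← hind.integral_fun_prod_comp (f := fun v z => ∏ i with k i = v, starIf (ε i) z)
    (fun v => (hc.measurable v).aemeasurable) fun v => (hcont v).aestronglyMeasurable]
  refine integral_congr_ae (ae_of_all _ fun ω => ?_)
  change ∏ i, starIf (ε i) (c (k i) ω) = ∏ v, ∏ i with k i = v, starIf (ε i) (c v ω)
  rw [← Finset.prod_fiberwise Finset.univ k]
  refine Finset.prod_congr rfl fun v _ => Finset.prod_congr rfl fun i hi => ?_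
  rw [(Finset.mem_filter.1 hi).2]

lemma IsInputSequence.integral_starIf (hc : IsInputSequence P c) (b : Bool) (j : ℕ) :
    ∫ ω, starIf b (c j ω) ∂P = 0 := by
  cases b
  · simpa [starIf] using hc.mean j
  · have := integral_conj (μ := P) (f := c j)
    rw [hc.mean j, map_zero] at this
    simpa [starIf] using this

lemma IsInputSequence.tupleMoment_eq_zero (hc : IsInputSequence P c) (ε : ι → Bool)
    {k : ι → Fin n} {i : ι} (hi : ∀ j, k j = k i → j = i) : tupleMoment P c ε k = 0 := by
  rw [hc.tupleMoment_eq_prod]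
  refine Finset.prod_eq_zero (Finset.mem_univ (k i)) ?_
  have : (Finset.univ.filter fun j => k j = k i) = {i} := by
    ext j
    simp only [Finset.mem_filter, Finset.mem_univ, true_and, Finset.mem_singleton]
    exact ⟨hi j, fun h => by rw [h]⟩
  simp only [this, Finset.prod_singleton]
  exact hc.integral_starIf _ _

/-- Each pair has opposite signs and contributes `E|c|^2`. The quantity `E c^2` never enters, which
is why real and complex inputs behave alike. -/
lemma IsInputSequence.tupleMoment_eq_one (hc : IsInputSequence P c) (ε : ι → Bool)
    {k : ι → Fin n} (h : ∀ i, ∃! j, j ≠ i ∧ k j = k i)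
    (hε : ∀ i j, j ≠ i → k j = k i → ε j ≠ ε i) : tupleMoment P c ε k = 1 := by
  classical
  have := hc.indep.isProbabilityMeasure
  rw [hc.tupleMoment_eq_prod]
  refine Finset.prod_eq_one fun v _ => ?_
  by_cases hv : ∃ i, k i = v
  · obtain ⟨i, rfl⟩ := hv
    obtain ⟨j, ⟨hj, hk⟩, hu⟩ := h i
    have hfib : (Finset.univ.filter fun j => k j = k i) = {i, j} := by
      ext l
      simp only [Finset.mem_filter, Finset.mem_univ, true_and, Finset.mem_insert,
        Finset.mem_singleton]
      constructor
      · intro hl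
        by_cases hli : l = i
        · exact Or.inl hli
        · exact Or.inr (hu l ⟨hli, hl⟩)
      · rintro (rfl | rfl)
        · rfl
        · exact hk
    have hprod : ∀ ω, ∏ l ∈ ({i, j} : Finset ι), starIf (ε l) (c (k i) ω) =
        ((‖c (k i) ω‖ ^ 2 : ℝ) : ℂ) := by
      intro ω
      rw [Finset.prod_pair hj.symm]
      have hne := hε i j hj hk
      have hz : c (k i) ω * star (c (k i) ω) = ((‖c (k i) ω‖ ^ 2 : ℝ) : ℂ) := by
        rw [Complex.star_def, Complex.mul_conj, Complex.normSq_eq_norm_sq]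
      cases hi : ε i <;> cases hj : ε j <;> simp only [hi, hj, ne_eq, not_true] at hne
      · simpa [starIf] using hz
      · rw [← hz, mul_comm]
        simp [starIf]
    simp only [hfib, hprod]
    rw [integral_complex_ofReal, hc.variance]
    simp
  · have : (Finset.univ.filter fun j => k j = v) = ∅ := by
      ext j
      simpa using fun h => hv ⟨j, h⟩
    simp [this]

variable [DecidableEq ι] [NeZero n]

/-- The difference between the moment of a tuple, restricted to the tuples of vanishing signed
sum, and the number of pairings matching the tuple. -/
def tupleError (P : Measure Ω) (c : ℕ → Ω → ℂ) (ε : ι → Bool) (k : ι → Fin n) : ℂ :=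
  (if ∑ i, signed (ε i) (k i) = 0 then tupleMoment P c ε k else 0) -
    (Finset.univ.filter fun τ : Pairing ε => Matched τ k).card

lemma IsInputSequence.norm_tupleError_le (hc : IsInputSequence P c) {B : ℝ}
    (hB : ∀ j, ∫ ω, ‖c j ω‖ ^ Fintype.card ι ∂P ≤ B) (ε : ι → Bool) (k : ι → Fin n) :
    ‖tupleError P c ε k‖ ≤ 1 + Fintype.card ι * B + Fintype.card (Pairing ε) := by
  have hM := hc.norm_tupleMoment_le hB ε k
  refine (norm_sub_le _ _).trans (add_le_add ?_ ?_)
  · split_ifs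
    · exact hM
    · rw [norm_zero]
      exact (norm_nonneg _).trans hM
  · rw [Complex.norm_natCast]
    exact_mod_cast Finset.card_le_univ _

/-- An isolated value makes both terms of the error vanish, and a tuple made of opposite-sign pairs
makes both equal to one. When all fibres are pairs there are `Fintype.card ι / 2` values; setting
aside that of an equal-sign pair leaves `Fintype.card ι / 2 - 1`. -/
lemma IsInputSequence.tupleError_ne_zero (hc : IsInputSequence P c) {ε : ι → Bool}
    {k : ι → Fin n} (h : tupleError P c ε k ≠ 0) :
    2 * (Finset.univ.image k).card < Fintype.card ι ∨
      ∃ a b, a ≠ b ∧ ε a = ε b ∧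
        k ∈ unbalancedTuples n ε a b (Fintype.card ι / 2 - 1) := by
  by_contra hcon
  push Not at hcon
  obtain ⟨h1, h2⟩ := hcon
  apply h
  have hnone : (∀ τ : Pairing ε, ¬ Matched τ k) →
      (if ∑ i, signed (ε i) (k i) = 0 then tupleMoment P c ε k else 0) = 0 →
      tupleError P c ε k = 0 := by
    intro hτ h0
    rw [tupleError, h0, Finset.filter_false_of_mem fun τ _ => hτ τ]
    simp
  by_cases hfib : ∀ i, ∃ j, j ≠ i ∧ k j = k i
  · have hle := two_mul_card_image_le hfib
    have hex := existsUnique_partner hfib h1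
    by_cases hε : ∀ i j, j ≠ i → k j = k i → ε j ≠ ε i
    · have hcard := card_matched_eq_one hex hε
      obtain ⟨τ, hτ⟩ := Finset.card_pos.1 (hcard.symm ▸ one_pos)
      rw [tupleError, hcard, if_pos (Finset.mem_filter.1 hτ).2.sum_signed,
        hc.tupleMoment_eq_one ε hex hε]
      simp
    · push Not at hε
      obtain ⟨i, j, hji, hk, he⟩ := hε
      have hfull : ∀ l, k l = k i → l = i ∨ l = j := by
        intro l hl
        by_cases hli : l = i
        · exact Or.inl hli
        · exact Or.inr ((hex i).unique ⟨hli, hl⟩ ⟨hji, hk⟩)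
      have hpos : 0 < (Finset.univ.image k).card :=
        Finset.card_pos.2 ⟨k i, Finset.mem_image_of_mem _ (Finset.mem_univ _)⟩
      have hsum : ¬ ∑ i, signed (ε i) (k i) = 0 := fun hs =>
        h2 i j hji.symm he.symm (Finset.mem_filter.2 ⟨Finset.mem_univ _, hk.symm, hfull,
          by omega, hs⟩)
      exact hnone (fun τ hτ => hsum hτ.sum_signed) (if_neg hsum)
  · push Not at hfib
    obtain ⟨i, hi⟩ := hfib
    have hi' : ∀ j, k j = k i → j = i := fun j hj => by
      by_contra hne
      exact hi j hne hj
    refine hnone (fun τ hτ => ?_) ?_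
    · obtain ⟨j, hj, hk, -⟩ := hτ.exists_partner i
      exact hj (hi' j hk)
    · rw [hc.tupleMoment_eq_zero ε hi', ite_self]

/-- A constant, depending only on the number of letters, controlling the number of tuples that
are not perfectly matched. -/
def errorCount (ι : Type*) [Fintype ι] : ℝ :=
  (((Fintype.card ι - 1) / 2 + 1) ^ Fintype.card ι : ℕ) +
    Fintype.card ι * (Fintype.card ι *
      (2 * (Fintype.card ι / 2 - 1 + 1) ^ Fintype.card ι : ℕ))

/-- Both exceptional families have at most `r` free values with `2 * r + 1 ≤ q`, so they fall short
of `√n ^ q` by at least one factor `√n`. -/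
lemma IsInputSequence.card_tupleError_ne_zero (hc : IsInputSequence P c) (ε : ι → Bool) :
    √n * (Finset.univ.filter fun k : ι → Fin n => tupleError P c ε k ≠ 0).card ≤
      errorCount ι * √n ^ Fintype.card ι := by
  classical
  set q := Fintype.card ι with hq
  have hn1 : (1 : ℝ) ≤ √n := by
    rw [Real.one_le_sqrt]
    exact_mod_cast NeZero.one_le
  have hpow : ∀ r, 2 * r + 1 ≤ q → √n * (n : ℝ) ^ r ≤ √n ^ q := by
    intro r hr
    calc √n * (n : ℝ) ^ r = √n ^ (2 * r + 1) := by
          rw [pow_succ, pow_mul, Real.sq_sqrt (Nat.cast_nonneg n), mul_comm]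
      _ ≤ √n ^ q := pow_le_pow_right₀ hn1 hr
  let S1 : Finset (ι → Fin n) :=
    Finset.univ.filter fun k => 2 * (Finset.univ.image k).card < q
  let S2 : ι → ι → Finset (ι → Fin n) := fun a b =>
    if a ≠ b ∧ ε a = ε b then unbalancedTuples n ε a b (q / 2 - 1) else ∅
  have hsub : (Finset.univ.filter fun k : ι → Fin n => tupleError P c ε k ≠ 0) ⊆
      S1 ∪ Finset.univ.biUnion fun a => Finset.univ.biUnion fun b => S2 a b := by
    intro k hk
    rcases hc.tupleError_ne_zero (Finset.mem_filter.1 hk).2 with h | ⟨a, b, hab, hε, h⟩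
    · exact Finset.mem_union_left _ (Finset.mem_filter.2 ⟨Finset.mem_univ _, h⟩)
    · refine Finset.mem_union_right _ (Finset.mem_biUnion.2 ⟨a, Finset.mem_univ _,
        Finset.mem_biUnion.2 ⟨b, Finset.mem_univ _, ?_⟩⟩)
      simp only [S2, if_pos (And.intro hab hε)]
      exact h
  have hS1 : √n * (S1.card : ℝ) ≤ (((q - 1) / 2 + 1) ^ q : ℕ) * √n ^ q := by
    -- For `q = 0` the truncated `r = (q - 1) / 2` violates `2 * r + 1 ≤ q`, but then `S1` is empty.
    rcases Nat.eq_zero_or_pos q with h0 | h0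
    · have : S1 = ∅ := Finset.filter_false_of_mem fun k _ => by omega
      rw [this, Finset.card_empty, Nat.cast_zero, mul_zero]
      positivity
    · have hle : S1.card ≤ ((q - 1) / 2 + 1) ^ q * n ^ ((q - 1) / 2) := by
        refine (Finset.card_le_card fun k hk => ?_).trans (card_image_le_count ((q - 1) / 2))
        have := (Finset.mem_filter.1 hk).2
        exact Finset.mem_filter.2 ⟨Finset.mem_univ _, by omega⟩
      calc √n * (S1.card : ℝ)
          ≤ √n * ((((q - 1) / 2 + 1) ^ q * n ^ ((q - 1) / 2) : ℕ) : ℝ) := by gcongr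
        _ = (((q - 1) / 2 + 1) ^ q : ℕ) * (√n * (n : ℝ) ^ ((q - 1) / 2)) := by
            push_cast
            ring
        _ ≤ _ := by
            gcongr
            exact hpow _ (by omega)
  have hS2 : ∀ a b, √n * ((S2 a b).card : ℝ) ≤
      (2 * (q / 2 - 1 + 1) ^ q : ℕ) * √n ^ q := by
    intro a b
    by_cases h : a ≠ b ∧ ε a = ε b
    · have hq2 : 2 ≤ q := by
        have : Nontrivial ι := ⟨a, b, h.1⟩
        exact Fintype.one_lt_card
      simp only [S2, if_pos h]
      calc √n * ((unbalancedTuples n ε a b (q / 2 - 1)).card : ℝ)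
          ≤ √n * ((2 * ((q / 2 - 1 + 1) ^ q * n ^ (q / 2 - 1)) : ℕ) : ℝ) := by
            gcongr
            exact card_unbalancedTuples_le h.1 h.2 _
        _ = (2 * (q / 2 - 1 + 1) ^ q : ℕ) * (√n * (n : ℝ) ^ (q / 2 - 1)) := by
            push_cast
            ring
        _ ≤ _ := by
            gcongr
            exact hpow _ (by omega)
    · simp only [S2, if_neg h, Finset.card_empty, Nat.cast_zero, mul_zero]
      positivity
  have hcard : ((Finset.univ.filter fun k : ι → Fin n => tupleError P c ε k ≠ 0).card : ℝ) ≤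
      S1.card + ∑ a, ∑ b, ((S2 a b).card : ℝ) := by
    have := (Finset.card_le_card hsub).trans ((Finset.card_union_le _ _).trans
      (Nat.add_le_add_left (Finset.card_biUnion_le.trans
        (Finset.sum_le_sum fun a _ => Finset.card_biUnion_le)) _))
    exact_mod_cast this
  calc _ ≤ √n * (S1.card + ∑ a, ∑ b, ((S2 a b).card : ℝ)) := by gcongr
    _ = √n * S1.card + ∑ a, ∑ b, √n * ((S2 a b).card : ℝ) := by
        simp only [mul_add, Finset.mul_sum]
    _ ≤ (((q - 1) / 2 + 1) ^ q : ℕ) * √n ^ q +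
          ∑ _a : ι, ∑ _b : ι, (2 * (q / 2 - 1 + 1) ^ q : ℕ) * √n ^ q := by
        exact add_le_add hS1 (Finset.sum_le_sum fun a _ => Finset.sum_le_sum fun b _ => hS2 a b)
    _ = _ := by
        simp only [Finset.sum_const, Finset.card_univ, nsmul_eq_mul, ← hq, errorCount]
        ring

theorem IsInputSequence.sum_norm_tupleError_le (hc : IsInputSequence P c) {B : ℝ}
    (hB : ∀ j, ∫ ω, ‖c j ω‖ ^ Fintype.card ι ∂P ≤ B) (ε : ι → Bool) :
    √n * ∑ k : ι → Fin n, ‖tupleError P c ε k‖ ≤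
      (errorCount ι * (1 + Fintype.card ι * B + Fintype.card (Pairing ε))) *
        √n ^ Fintype.card ι := by
  classical
  set D := 1 + Fintype.card ι * B + Fintype.card (Pairing ε) with hD
  have hD0 : 0 ≤ D :=
    (norm_nonneg _).trans (hc.norm_tupleError_le hB ε (fun _ : ι => (0 : Fin n)))
  have hsum : ∑ k : ι → Fin n, ‖tupleError P c ε k‖ ≤
      (Finset.univ.filter fun k : ι → Fin n => tupleError P c ε k ≠ 0).card * D := by
    rw [← Finset.sum_filter_of_ne (p := fun k : ι → Fin n => tupleError P c ε k ≠ 0)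
      fun k _ hk => norm_ne_zero_iff.1 hk, ← nsmul_eq_mul]
    exact Finset.sum_le_card_nsmul _ _ _ fun k _ => hc.norm_tupleError_le hB ε k
  calc _ ≤ √n * ((Finset.univ.filter fun k : ι → Fin n => tupleError P c ε k ≠ 0).card * D) := by
        gcongr
    _ = (√n * (Finset.univ.filter fun k : ι → Fin n => tupleError P c ε k ≠ 0).card) * D := by
        ring
    _ ≤ (errorCount ι * √n ^ Fintype.card ι) * D := by
        exact mul_le_mul_of_nonneg_right (hc.card_tupleError_ne_zero ε) hD0
    _ = _ := by ring

end Moments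

/-! ### Walks and entries of alternating products -/

/-- The position at time `t` of the walk started at `j` with signed steps `k`. -/
def walk {G : Type*} [AddCommGroup G] {q : ℕ} (j : G) (ε : Fin q → Bool) (k : Fin q → G)
    (t : Fin (q + 1)) : G :=
  j + ∑ s : Fin q, if s.castSucc < t then signed (ε s) (k s) else 0

section Walk

variable {G : Type*} [AddCommGroup G] {q : ℕ}

lemma walk_zero (j : G) (ε : Fin q → Bool) (k : Fin q → G) : walk j ε k 0 = j := by
  simp [walk]

lemma walk_last (j : G) (ε : Fin q → Bool) (k : Fin q → G) :
    walk j ε k (Fin.last q) = j + ∑ s, signed (ε s) (k s) := by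
  simp [walk, Fin.castSucc_lt_last]

lemma walk_succ (j : G) (ε : Fin (q + 1) → Bool) (k : Fin (q + 1) → G) (t : Fin (q + 1)) :
    walk j ε k t.succ =
      walk (j + signed (ε 0) (k 0)) (fun s => ε s.succ) (fun s => k s.succ) t := by
  simp only [walk, Fin.sum_univ_succ, Fin.castSucc_zero, Fin.succ_pos, if_true, add_assoc]
  simp only [← Fin.succ_castSucc, Fin.succ_lt_succ_iff]

lemma map_walk {G' : Type*} [AddCommGroup G'] (φ : G →+ G') (j : G) (ε : Fin q → Bool)
    (k : Fin q → G) (t : Fin (q + 1)) :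
    φ (walk j ε k t) = walk (φ j) ε (fun s => φ (k s)) t := by
  simp only [walk, map_add, map_sum, apply_ite φ, map_zero]
  congr 2
  funext s
  unfold signed
  split_ifs <;> simp

end Walk

/-- The diagonal matrix with entries `f (j / n)`. -/
def diagFn (n : ℕ) (f : ℝ → ℂ) : Matrix (Fin n) (Fin n) ℂ :=
  Matrix.diagonal fun j => f (((j : ℕ) : ℝ) / n)

/-- The product `f₀ C^{ε₀} f₁ C^{ε₁} ⋯`, with functions read as diagonal matrices. -/
def altProd (n : ℕ) (C : Matrix (Fin n) (Fin n) ℂ) {q : ℕ} (ε : Fin q → Bool)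
    (f : Fin (q + 1) → ℝ → ℂ) : Matrix (Fin n) (Fin n) ℂ :=
  diagFn n (f 0) * (List.ofFn fun t : Fin q => starIf (ε t) C * diagFn n (f t.succ)).prod

lemma altProd_succ (n : ℕ) (C : Matrix (Fin n) (Fin n) ℂ) {q : ℕ} (ε : Fin (q + 1) → Bool)
    (f : Fin (q + 2) → ℝ → ℂ) :
    altProd n C ε f = diagFn n (f 0) * (starIf (ε 0) C *
      altProd n C (fun s => ε s.succ) fun s => f s.succ) := by
  simp only [altProd, List.ofFn_succ, List.prod_cons, mul_assoc]

/-- A circulant entry depends only on the step between its indices, and the adjoint traverses that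
step backwards. -/
lemma starIf_circ_apply {n : ℕ} [NeZero n] (v : Fin n → ℂ) (b : Bool) (j x : Fin n) :
    starIf b (circ v) j (j + signed b x) = starIf b (v x) := by
  cases b
  · simp [starIf, signed, circ]
  · simp [starIf, signed, circ, Matrix.star_apply]

lemma sum_starIf_circ_mul {n : ℕ} [NeZero n] (v : Fin n → ℂ) (b : Bool) (j : Fin n)
    (g : Fin n → ℂ) :
    ∑ i, starIf b (circ v) j i * g i = ∑ x, starIf b (v x) * g (j + signed b x) := by
  have hbij : Function.Bijective fun x : Fin n => j + signed b x := by
    cases b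
    · exact (Equiv.addLeft j).bijective
    · exact ((Equiv.neg (Fin n)).trans (Equiv.addLeft j)).bijective
  rw [← hbij.sum_comp]
  exact Finset.sum_congr rfl fun x _ => by rw [starIf_circ_apply]

lemma altProd_apply {n : ℕ} [NeZero n] (v : Fin n → ℂ) {q : ℕ} (ε : Fin q → Bool)
    (f : Fin (q + 1) → ℝ → ℂ) (j l : Fin n) :
    altProd n (circ v) ε f j l = ∑ k : Fin q → Fin n,
      (∏ s, starIf (ε s) (v (k s))) *
        (∏ t, f t (((walk j ε k t : Fin n) : ℕ) / n : ℝ)) *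
          if walk j ε k (Fin.last q) = l then 1 else 0 := by
  induction q generalizing j with
  | zero =>
    simp [altProd, diagFn, walk, Matrix.one_apply]
  | succ q ih =>
    rw [altProd_succ, diagFn, Matrix.diagonal_mul, Matrix.mul_apply, sum_starIf_circ_mul,
      ← (Fin.consEquiv fun _ : Fin (q + 1) => Fin n).sum_comp, Fintype.sum_prod_type,
      Finset.mul_sum]
    refine Finset.sum_congr rfl fun x _ => ?_
    rw [ih, Finset.mul_sum, Finset.mul_sum]
    refine Finset.sum_congr rfl fun k _ => ?_
    have hlast : walk j ε (Fin.cons x k : Fin (q + 1) → Fin n) (Fin.last (q + 1)) =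
        walk (j + signed (ε 0) x) (fun s => ε s.succ) k (Fin.last q) := by
      rw [← Fin.succ_last, walk_succ]
      rfl
    have hprod : ∏ t, f t (((walk j ε (Fin.cons x k : Fin (q + 1) → Fin n) t : Fin n) : ℕ) / n : ℝ)
        = f 0 ((j : ℕ) / n : ℝ) * ∏ t : Fin (q + 1), f t.succ
          (((walk (j + signed (ε 0) x) (fun s => ε s.succ) k t : Fin n) : ℕ) / n : ℝ) := by
      rw [Fin.prod_univ_succ, walk_zero]
      congr 1
      refine Finset.prod_congr rfl fun t _ => ?_
      rw [walk_succ]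
      rfl
    change _ = (∏ s, starIf (ε s) (v ((Fin.cons x k : Fin (q + 1) → Fin n) s))) *
      (∏ t, f t (((walk j ε (Fin.cons x k : Fin (q + 1) → Fin n) t : Fin n) : ℕ) / n : ℝ)) *
      if walk j ε (Fin.cons x k : Fin (q + 1) → Fin n) (Fin.last (q + 1)) = l then 1 else 0
    have hstep : ∏ s, starIf (ε s) (v ((Fin.cons x k : Fin (q + 1) → Fin n) s)) =
        starIf (ε 0) (v x) * ∏ s : Fin q, starIf (ε s.succ) (v (k s)) := by
      rw [Fin.prod_univ_succ]
      simp only [Fin.cons_zero, Fin.cons_succ]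
    rw [hlast, hprod, hstep]
    ring

/-- The product of the diagonal functions along the walk. -/
def walkWeight {n : ℕ} [NeZero n] {q : ℕ} (ε : Fin q → Bool) (f : Fin (q + 1) → ℝ → ℂ)
    (j : Fin n) (k : Fin q → Fin n) : ℂ :=
  ∏ t, f t (((walk j ε k t : Fin n) : ℕ) / n : ℝ)

lemma trace_altProd {n : ℕ} [NeZero n] (v : Fin n → ℂ) {q : ℕ} (ε : Fin q → Bool)
    (f : Fin (q + 1) → ℝ → ℂ) :
    (altProd n (circ v) ε f).trace = ∑ j : Fin n, ∑ k : Fin q → Fin n,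
      (if ∑ s, signed (ε s) (k s) = 0 then ∏ s, starIf (ε s) (v (k s)) else 0) *
        walkWeight ε f j k := by
  simp only [Matrix.trace, Matrix.diag_apply, altProd_apply, walk_last, add_eq_left]
  refine Finset.sum_congr rfl fun j _ => Finset.sum_congr rfl fun k _ => ?_
  rw [walkWeight]
  split_ifs <;> simp

/-! ### Words as alternating products -/

lemma circ_smul {n : ℕ} (s : ℂ) (v : Fin n → ℂ) : circ (fun k => s * v k) = s • circ v := by
  ext i j
  simp [circ]

/-- Continuous functions bounded by one. -/
def IsTame (f : ℝ → ℂ) : Prop := Continuous f ∧ ∀ u, ‖f u‖ ≤ 1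

lemma isTame_one : IsTame fun _ => 1 := ⟨continuous_const, fun _ => by simp⟩

lemma IsTame.mul {f g : ℝ → ℂ} (hf : IsTame f) (hg : IsTame g) : IsTame fun u => f u * g u :=
  ⟨hf.1.mul hg.1, fun u => by
    rw [norm_mul]
    exact mul_le_one₀ (hf.2 u) (norm_nonneg _) (hg.2 u)⟩

lemma IsTame.starIf {f : ℝ → ℂ} (hf : IsTame f) (b : Bool) : IsTame fun u => starIf b (f u) :=
  ⟨(continuous_starIf b).comp hf.1, fun u => by rw [norm_starIf]; exact hf.2 u⟩

lemma diagFn_mul (n : ℕ) (f g : ℝ → ℂ) :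
    diagFn n f * diagFn n g = diagFn n fun u => f u * g u :=
  Matrix.diagonal_mul_diagonal _ _

lemma starIf_diagFn (n : ℕ) (f : ℝ → ℂ) (b : Bool) :
    starIf b (diagFn n f) = diagFn n fun u => starIf b (f u) := by
  cases b
  · rfl
  · exact Matrix.diagonal_conjTranspose _

lemma diagFn_one (n : ℕ) : diagFn n (fun _ => 1) = 1 := Matrix.diagonal_one

lemma evalWord_cons {ι A : Type*} [Monoid A] [Star A] (a : ι → A) (p : ι × Bool)
    (w : List (ι × Bool)) : evalWord a (p :: w) = starIf p.2 (a p.1) * evalWord a w := by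
  simp [evalWord, starIf]

/-- Consecutive diagonal letters merge into one function, and empty gaps get the constant `1`. The
data do not depend on `n` or `C`, so one limit serves all models. The clauses on letter counts and
constant functions serve the moments of `N`. -/
lemma exists_altProd {e : ℝ → ℂ} (he : IsTame e) (w : List (Fin 2 × Bool)) :
    ∃ (q : ℕ) (ε : Fin q → Bool) (f : Fin (q + 1) → ℝ → ℂ),
      (∀ t, IsTame (f t)) ∧
      (∀ b, Fintype.card {s // ε s = b} = w.count (0, b)) ∧
      ((∀ p ∈ w, p.1 = 0) → ∀ t, f t = fun _ => 1) ∧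
      ∀ (n : ℕ) (C : Matrix (Fin n) (Fin n) ℂ),
        evalWord ![C, diagFn n e] w = altProd n C ε f := by
  induction w with
  | nil =>
    refine ⟨0, Fin.elim0, fun _ _ => 1, fun _ => isTame_one, fun b => ?_, fun _ _ => rfl,
      fun n C => ?_⟩
    · simp
    · simp [evalWord, altProd, diagFn_one]
  | cons p w ih =>
    obtain ⟨q, ε, f, hf, hcount, hone, heval⟩ := ih
    obtain ⟨i, b⟩ := p
    fin_cases i
    · refine ⟨q + 1, Fin.cons b ε, Fin.cons (fun _ => 1) f, ?_, fun b' => ?_, fun h t => ?_,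
        fun n C => ?_⟩
      · refine Fin.cases ?_ ?_
        · exact isTame_one
        · exact hf
      · have hset : Fintype.card {s // (Fin.cons b ε : Fin (q + 1) → Bool) s = b'} =
            Fintype.card {s // ε s = b'} + if b = b' then 1 else 0 := by
          rw [Fintype.card_subtype, Fintype.card_subtype, Fin.card_filter_univ_succ]
          simp only [Fin.cons_zero, Fin.cons_succ]
          split_ifs <;> simp
        rw [hset, hcount, List.count_cons]
        simp
      · refine Fin.cases ?_ (fun t => ?_) t
        · rfl
        · exact hone (fun p hp => h p (List.mem_cons_of_mem _ hp)) t
      · rw [evalWord_cons, heval, altProd_succ]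
        simp [diagFn_one]
    · refine ⟨q, ε, Fin.cons (fun u => starIf b (e u) * f 0 u) fun t => f t.succ, ?_, fun b' => ?_,
        fun h => ?_, fun n C => ?_⟩
      · refine Fin.cases ?_ ?_
        · exact (he.starIf b).mul (hf 0)
        · exact fun t => hf t.succ
      · rw [hcount, List.count_cons]
        simp
      · exact absurd (h _ List.mem_cons_self) (by simp)
      · rw [evalWord_cons, heval, altProd, altProd, ← mul_assoc]
        simp [starIf_diagFn, diagFn_mul]

/-! ### The contribution of a pairing -/

section PairingSum

variable {ι : Type*} {ε : ι → Bool}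

/-- The position of sign `false` in the pair of a given position. -/
def Pairing.rep (τ : Pairing ε) (i : ι) : {i // ε i = false} :=
  if h : ε i = false then ⟨i, h⟩ else τ.symm ⟨i, by simpa using h⟩

lemma Pairing.rep_false (τ : Pairing ε) (i : {i // ε i = false}) : τ.rep i.1 = i := by
  simp [Pairing.rep, i.2]

lemma Pairing.rep_true (τ : Pairing ε) (i : {i // ε i = true}) : τ.rep i.1 = τ.symm i := by
  simp [Pairing.rep, i.2]

lemma Pairing.matched_comp_rep {κ : Type*} (τ : Pairing ε) (x : {i // ε i = false} → κ) :
    Matched τ fun i => x (τ.rep i) := by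
  intro h
  simp only [τ.rep_true, τ.rep_false, τ.symm_apply_apply]

lemma Matched.comp_rep {κ : Type*} {τ : Pairing ε} {k : ι → κ} (h : Matched τ k) (i : ι) :
    k (τ.rep i).1 = k i := by
  rcases hi : ε i with _ | _
  · rw [show i = (⟨i, hi⟩ : {i // ε i = false}).1 from rfl, τ.rep_false]
  · have := h (τ.symm ⟨i, hi⟩)
    rw [τ.apply_symm_apply] at this
    rw [show i = (⟨i, hi⟩ : {i // ε i = true}).1 from rfl, τ.rep_true, this]

lemma sum_matched [Fintype ι] [DecidableEq ι] {κ M : Type*} [Fintype κ] [DecidableEq κ]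
    [AddCommMonoid M] (τ : Pairing ε) (g : (ι → κ) → M) :
    ∑ k with Matched τ k, g k = ∑ x : {i // ε i = false} → κ, g fun i => x (τ.rep i) := by
  refine Finset.sum_bij' (fun k _ h => k h.1) (fun x _ i => x (τ.rep i)) (fun _ _ => by simp)
    (fun x _ => by simpa using τ.matched_comp_rep x) (fun k hk => ?_) (fun x _ => ?_)
    (fun k hk => ?_)
  · funext i
    exact (Finset.mem_filter.1 hk).2.comp_rep i
  · funext h
    simp only [τ.rep_false]
  · congr 1
    funext i
    exact ((Finset.mem_filter.1 hk).2.comp_rep i).symm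

end PairingSum

/-- The additive embedding of `Fin n` in the circle. -/
def finToCircle (n : ℕ) [NeZero n] : Fin n →+ UnitAddCircle :=
  AddMonoidHom.mk' (fun x => (((x : ℕ) / n : ℝ) : UnitAddCircle)) <| by
    intro x y
    have hn : (n : ℝ) ≠ 0 := Nat.cast_ne_zero.2 (NeZero.ne n)
    rw [← AddCircle.coe_add, ← sub_eq_zero, ← AddCircle.coe_sub, AddCircle.coe_eq_zero_iff]
    refine ⟨-(((x : ℕ) + y : ℕ) / n : ℕ), ?_⟩
    have h := Nat.mod_add_div ((x : ℕ) + y) n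
    rw [← Fin.val_add] at h
    have h' : (((x + y : Fin n) : ℕ) : ℝ) + n * (((x : ℕ) + y) / n : ℕ) = (x : ℕ) + (y : ℕ) := by
      exact_mod_cast h
    rw [← add_div, ← sub_div, ← h']
    simp only [zsmul_eq_mul, mul_one, Int.cast_neg, Int.cast_natCast]
    field_simp
    ring

/-- Both sides lie in `[0, 1)` and represent the same point of the circle, so reduction modulo `n`
becomes the fractional part. -/
lemma walk_val_div {n : ℕ} [NeZero n] {q : ℕ} (ε : Fin q → Bool) (j : Fin n)
    (k : Fin q → Fin n) (t : Fin (q + 1)) :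
    (((walk j ε k t : Fin n) : ℕ) / n : ℝ) =
      Int.fract (walk ((j : ℕ) / n : ℝ) ε (fun s => ((k s : ℕ) / n : ℝ)) t) := by
  have hn : (0 : ℝ) < n := Nat.cast_pos.2 (NeZero.pos n)
  have h1 := map_walk (finToCircle n) j ε k t
  have h2 := map_walk (QuotientAddGroup.mk' (AddSubgroup.zmultiples (1 : ℝ)))
    ((j : ℕ) / n : ℝ) ε (fun s => ((k s : ℕ) / n : ℝ)) t
  have h3 : (((((walk j ε k t : Fin n) : ℕ) / n : ℝ)) : UnitAddCircle) =
      ((walk ((j : ℕ) / n : ℝ) ε (fun s => ((k s : ℕ) / n : ℝ)) t : ℝ) : UnitAddCircle) :=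
    h1.trans h2.symm
  rw [← sub_eq_zero, ← AddCircle.coe_sub, AddCircle.coe_eq_zero_iff] at h3
  obtain ⟨m, hm⟩ := h3
  rw [eq_comm, Int.fract_eq_iff]
  refine ⟨by positivity, ?_, -m, ?_⟩
  · rw [div_lt_one hn]
    exact_mod_cast (walk j ε k t).2
  · rw [zsmul_eq_mul, mul_one] at hm
    push_cast
    linarith

section Limit

variable {q : ℕ} (ε : Fin q → Bool) (f : Fin (q + 1) → ℝ → ℂ)

/-- The integrand of the contribution of a pairing to the limit. -/
def pairingIntegrand (τ : Pairing ε) (u : Option {s // ε s = false} → ℝ) : ℂ :=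
  ∏ t, f t (Int.fract (walk (u none) ε (fun s => u (some (τ.rep s))) t))

/-- The Riemann sum of the contributions of all pairings. -/
def pairingSum (n : ℕ) : ℂ :=
  ∑ τ : Pairing ε, ((n : ℂ) ^ Fintype.card (Option {s // ε s = false}))⁻¹ *
    ∑ y : Option {s // ε s = false} → Fin n,
      pairingIntegrand ε f τ fun i => ((y i : ℕ) : ℝ) / n

/-- The limit of the normalised traces of an alternating product. -/
def altLimit : ℂ :=
  ∑ τ : Pairing ε, ∫ u in unitCube (Option {s // ε s = false}), pairingIntegrand ε f τ u

variable {ε f}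

lemma continuous_walk (τ : Pairing ε) (t : Fin (q + 1)) :
    Continuous fun u : Option {s // ε s = false} → ℝ =>
      walk (u none) ε (fun s => u (some (τ.rep s))) t := by
  unfold walk
  refine (continuous_apply none).add (continuous_finsetSum _ fun s _ => ?_)
  split_ifs
  · unfold signed
    split_ifs
    · exact (continuous_apply _).neg
    · exact continuous_apply _
  · exact continuous_const

lemma norm_pairingIntegrand_le (hf : ∀ t, IsTame (f t)) (τ : Pairing ε)
    (u : Option {s // ε s = false} → ℝ) : ‖pairingIntegrand ε f τ u‖ ≤ 1 := by
  rw [pairingIntegrand, norm_prod]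
  exact Finset.prod_le_one (fun _ _ => norm_nonneg _) fun t _ => (hf t).2 _

lemma measurable_pairingIntegrand (hf : ∀ t, IsTame (f t)) (τ : Pairing ε) :
    Measurable (pairingIntegrand ε f τ) :=
  Finset.measurable_fun_prod _ fun t _ =>
    (hf t).1.measurable.comp (measurable_fract.comp (continuous_walk τ t).measurable)

/-- The position is a linear form in which the starting point `u none` has coefficient one. It is
therefore onto, even if all steps cancel, and preimages of null sets are null. -/
lemma ae_walk_notMem_range_intCast (τ : Pairing ε) (t : Fin (q + 1)) :
    ∀ᵐ u : Option {s // ε s = false} → ℝ,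
      walk (u none) ε (fun s => u (some (τ.rep s))) t ∈ (Set.range ((↑) : ℤ → ℝ))ᶜ := by
  let ℓ : (Option {s // ε s = false} → ℝ) →ₗ[ℝ] ℝ :=
    LinearMap.proj none + ∑ s : Fin q, if s.castSucc < t then
      (if ε s then -LinearMap.proj (some (τ.rep s)) else LinearMap.proj (some (τ.rep s))) else 0
  have hℓ : ∀ u, ℓ u = walk (u none) ε (fun s => u (some (τ.rep s))) t := by
    intro u
    simp only [ℓ, LinearMap.add_apply, LinearMap.proj_apply, LinearMap.sum_apply, walk, signed]
    congr 1
    refine Finset.sum_congr rfl fun s _ => ?_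
    split_ifs <;> simp
  have hsurj : Function.Surjective ℓ := fun r => ⟨Pi.single none r, by
    rw [hℓ]
    simp [walk, signed]⟩
  have hnull : ∀ᵐ y : ℝ, y ∈ (Set.range ((↑) : ℤ → ℝ))ᶜ :=
    (Set.countable_range _).ae_notMem _
  have h := (ae_comp_linearMap_mem_iff ℓ volume volume hsurj
    (Set.countable_range ((↑) : ℤ → ℝ)).measurableSet.compl).2 hnull
  simpa only [hℓ] using h

lemma ae_continuousAt_pairingIntegrand (hf : ∀ t, IsTame (f t)) (τ : Pairing ε) :
    ∀ᵐ u, ContinuousAt (pairingIntegrand ε f τ) u := by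
  filter_upwards [ae_all_iff.2 fun t => ae_walk_notMem_range_intCast τ t] with u hu
  refine tendsto_finsetProd _ fun t _ => ?_
  refine ((hf t).1.tendsto _).comp (ContinuousAt.comp (g := Int.fract) ?_
    (continuous_walk τ t).continuousAt)
  exact continuousAt_fract fun h => hu t ⟨_, h.symm⟩

lemma tendsto_pairingSum (hf : ∀ t, IsTame (f t)) :
    Tendsto (pairingSum ε f) atTop (𝓝 (altLimit ε f)) :=
  tendsto_finsetSum _ fun τ _ => tendsto_riemannSum (measurable_pairingIntegrand hf τ)
    (norm_pairingIntegrand_le hf τ) (ae_continuousAt_pairingIntegrand hf τ)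

lemma altLimit_one (h : ∀ t, f t = fun _ => 1) :
    altLimit ε f = Fintype.card (Pairing ε) := by
  have : ∀ τ : Pairing ε, pairingIntegrand ε f τ = fun _ => 1 := fun τ => by
    funext u
    simp [pairingIntegrand, h]
  simp [altLimit, this, measureReal_def, volume_unitCube]

lemma norm_walkWeight_le {n : ℕ} [NeZero n] (hf : ∀ t, IsTame (f t)) (j : Fin n)
    (k : Fin q → Fin n) : ‖walkWeight ε f j k‖ ≤ 1 := by
  rw [walkWeight, norm_prod]
  exact Finset.prod_le_one (fun _ _ => norm_nonneg _) fun t _ => (hf t).2 _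

lemma card_eq_two_mul_of_pairing (τ : Pairing ε) :
    q = 2 * Fintype.card {s // ε s = false} := by
  have h := sum_eq_sum_signs ε fun _ => 1
  simp only [Finset.sum_const, Finset.card_univ, smul_eq_mul, mul_one, Fintype.card_fin] at h
  have h' := Fintype.card_congr τ
  omega

/-- Exchanging the sums over tuples and pairings leaves, for each pairing, the starting point (the
coordinate `none`) and one free step per pair. The powers of `n` agree because `q` is twice the
number of pairs. -/
lemma pairingSum_eq (n : ℕ) [NeZero n] :
    pairingSum ε f n = (n : ℂ)⁻¹ * ((√n : ℝ) : ℂ)⁻¹ ^ q *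
      ∑ j : Fin n, ∑ k : Fin q → Fin n,
        ((Finset.univ.filter fun τ : Pairing ε => Matched τ k).card : ℂ) * walkWeight ε f j k := by
  have hcard : ∀ k : Fin q → Fin n,
      ((Finset.univ.filter fun τ : Pairing ε => Matched τ k).card : ℂ) =
        ∑ τ : Pairing ε, if Matched τ k then 1 else 0 := fun k => by
    rw [Finset.card_filter]
    push_cast
    rfl
  have hswap : ∑ j : Fin n, ∑ k : Fin q → Fin n,
        ((Finset.univ.filter fun τ : Pairing ε => Matched τ k).card : ℂ) * walkWeight ε f j k =
      ∑ τ : Pairing ε, ∑ j : Fin n, ∑ x : {s // ε s = false} → Fin n,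
        walkWeight ε f j fun s => x (τ.rep s) := by
    conv_rhs => rw [Finset.sum_comm]
    refine Finset.sum_congr rfl fun j _ => ?_
    simp only [hcard, Finset.sum_mul]
    rw [Finset.sum_comm]
    refine Finset.sum_congr rfl fun τ _ => ?_
    rw [← sum_matched τ fun k => walkWeight ε f j k, Finset.sum_filter]
    refine Finset.sum_congr rfl fun k _ => ?_
    split_ifs <;> simp
  rw [hswap, pairingSum, Finset.mul_sum]
  refine Finset.sum_congr rfl fun τ _ => ?_
  have hpow : ((√n : ℝ) : ℂ)⁻¹ ^ q = ((n : ℂ) ^ Fintype.card {s // ε s = false})⁻¹ := by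
    rw [inv_pow]
    congr 1
    conv_lhs => rw [card_eq_two_mul_of_pairing τ, pow_mul]
    rw [← Complex.ofReal_pow, Real.sq_sqrt (Nat.cast_nonneg n), Complex.ofReal_natCast]
  rw [hpow, Fintype.card_option, pow_succ, mul_inv, mul_comm _ (n : ℂ)⁻¹]
  congr 1
  rw [← (Equiv.piOptionEquivProd (β := fun _ => Fin n)).symm.sum_comp, Fintype.sum_prod_type]
  refine Finset.sum_congr rfl fun j _ => Finset.sum_congr rfl fun x _ => ?_
  simp only [pairingIntegrand, walkWeight, walk_val_div]
  rfl

end Limit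

/-! ### Moments of words in the random matrices -/

section WordMoments

variable {Ω : Type*} [MeasurableSpace Ω] {P : Measure Ω} [IsProbabilityMeasure P]
  {c : ℕ → Ω → ℂ}

lemma evalWord_map {ι A B F : Type*} [Monoid A] [Star A] [Monoid B] [Star B] [FunLike F A B]
    [MonoidHomClass F A B] [StarHomClass F A B] (φ : F) (a : ι → A) (w : List (ι × Bool)) :
    φ (evalWord a w) = evalWord (fun i => φ (a i)) w := by
  rw [evalWord, evalWord, map_list_prod, List.map_map]
  congr 2
  funext p
  simp only [Function.comp_apply, apply_ite φ, map_star]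

lemma evalWord_randMat_apply {ι : Type*} {n : ℕ} (a : ι → randMat P n) (w : List (ι × Bool))
    (ω : Ω) : (evalWord a w).1 ω = evalWord (fun i => (a i).1 ω) w := by
  induction w with
  | nil => simp [evalWord]
  | cons p w ih =>
    rw [evalWord_cons, evalWord_cons, ← ih]
    unfold starIf
    split_ifs <;> rfl

/-- The function `u ↦ exp (iθu)`. -/
def expFn (θ u : ℝ) : ℂ := Complex.exp (((θ * u : ℝ) : ℂ) * Complex.I)

lemma isTame_expFn (θ : ℝ) : IsTame (expFn θ) :=
  ⟨by unfold expFn; fun_prop, fun u => by rw [expFn, Complex.norm_exp_ofReal_mul_I]⟩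

lemma diagMat_apply (θ : ℝ) (n : ℕ) (ω : Ω) : (diagMat P θ n).1 ω = diagFn n (expFn θ) := by
  change Matrix.diagonal _ = Matrix.diagonal _
  congr 1
  funext j
  rw [expFn, ← Complex.exp_nat_mul]
  congr 1
  push_cast
  ring

lemma starIf_mul_of_star_eq {s : ℂ} (hs : star s = s) (b : Bool) (z : ℂ) :
    starIf b (s * z) = s * starIf b z := by
  unfold starIf
  split_ifs
  · rw [star_mul', hs]
  · rfl

lemma meanTrace_evalWord_eq (hc : IsInputSequence P c) (θ : ℝ) {n : ℕ} [NeZero n]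
    {q : ℕ} {ε : Fin q → Bool} {f : Fin (q + 1) → ℝ → ℂ} {w : List (Fin 2 × Bool)}
    (hw : ∀ C : Matrix (Fin n) (Fin n) ℂ, evalWord ![C, diagFn n (expFn θ)] w = altProd n C ε f) :
    meanTrace P n (evalWord ![((√n : ℝ) : ℂ)⁻¹ • circulantMat hc n, diagMat P θ n] w) =
      (n : ℂ)⁻¹ * ((√n : ℝ) : ℂ)⁻¹ ^ q * ∑ j : Fin n, ∑ k : Fin q → Fin n,
        (if ∑ s, signed (ε s) (k s) = 0 then tupleMoment P c ε k else 0) *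
          walkWeight ε f j k := by
  set s : ℂ := ((√n : ℝ) : ℂ)⁻¹ with hs
  have hstar : star s = s := by simp [hs]
  have hval : ∀ ω, (evalWord ![s • circulantMat hc n, diagMat P θ n] w).1 ω =
      altProd n (circ fun k : Fin n => s * c k ω) ε f := by
    intro ω
    rw [evalWord_randMat_apply, ← hw]
    congr 1
    funext i
    fin_cases i
    · exact (circ_smul s _).symm
    · exact diagMat_apply θ n ω
  have htrace : ∀ ω, ((evalWord ![s • circulantMat hc n, diagMat P θ n] w).1 ω).trace =
      ∑ j : Fin n, ∑ k : Fin q → Fin n, (if ∑ s, signed (ε s) (k s) = 0 then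
        s ^ q * ∏ s, starIf (ε s) (c (k s) ω) else 0) * walkWeight ε f j k := by
    intro ω
    rw [hval, trace_altProd]
    simp only [starIf_mul_of_star_eq hstar, Finset.prod_mul_distrib, Finset.prod_const,
      Finset.card_univ, Fintype.card_fin]
  have hint : ∀ (j : Fin n) (k : Fin q → Fin n), Integrable (fun ω =>
      (if ∑ s, signed (ε s) (k s) = 0 then
        s ^ q * ∏ s, starIf (ε s) (c (k s) ω) else 0) * walkWeight ε f j k) P := by
    intro j k
    refine Integrable.mul_const ?_ _
    split_ifs
    · exact (hc.integrable_prod ε k).const_mul _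
    · exact integrable_zero _ _ _
  change (n : ℂ)⁻¹ * ∫ ω, _ ∂P = _
  simp only [htrace]
  rw [integral_finsetSum _ fun j _ => integrable_finsetSum _ fun k _ => hint j k, mul_assoc]
  congr 1
  rw [Finset.mul_sum]
  refine Finset.sum_congr rfl fun j _ => ?_
  rw [integral_finsetSum _ fun k _ => hint j k, Finset.mul_sum]
  refine Finset.sum_congr rfl fun k _ => ?_
  rw [integral_mul_const, ← mul_assoc]
  congr 1
  split_ifs
  · rw [integral_const_mul]
    rfl
  · simp

lemma norm_meanTrace_evalWord_sub_le (hc : IsInputSequence P c) (θ : ℝ) {n : ℕ} [NeZero n]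
    {q : ℕ} {ε : Fin q → Bool} {f : Fin (q + 1) → ℝ → ℂ} (hf : ∀ t, IsTame (f t))
    {w : List (Fin 2 × Bool)}
    (hw : ∀ C : Matrix (Fin n) (Fin n) ℂ, evalWord ![C, diagFn n (expFn θ)] w = altProd n C ε f)
    {B : ℝ} (hB : ∀ j, ∫ ω, ‖c j ω‖ ^ q ∂P ≤ B) :
    ‖meanTrace P n (evalWord ![((√n : ℝ) : ℂ)⁻¹ • circulantMat hc n, diagMat P θ n] w) -
        pairingSum ε f n‖ ≤
      errorCount (Fin q) * (1 + q * B + Fintype.card (Pairing ε)) * (√n)⁻¹ := by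
  have hn : (0 : ℝ) < n := Nat.cast_pos.2 (NeZero.pos n)
  have hsq : 0 < √n := Real.sqrt_pos.2 hn
  have herr := hc.sum_norm_tupleError_le (ι := Fin q) (n := n) (B := B)
    (by simpa using hB) ε
  rw [Fintype.card_fin] at herr
  rw [meanTrace_evalWord_eq hc θ hw, pairingSum_eq, ← mul_sub, ← Finset.sum_sub_distrib]
  simp only [← Finset.sum_sub_distrib, ← sub_mul]
  change ‖(n : ℂ)⁻¹ * ((√n : ℝ) : ℂ)⁻¹ ^ q * ∑ j : Fin n, ∑ k : Fin q → Fin n,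
    tupleError P c ε k * walkWeight ε f j k‖ ≤ _
  have hsum : ‖∑ j : Fin n, ∑ k : Fin q → Fin n, tupleError P c ε k * walkWeight ε f j k‖ ≤
      n * ∑ k : Fin q → Fin n, ‖tupleError P c ε k‖ := by
    refine (norm_sum_le _ _).trans ?_
    have hj : ∀ j : Fin n, ‖∑ k : Fin q → Fin n, tupleError P c ε k * walkWeight ε f j k‖ ≤
        ∑ k : Fin q → Fin n, ‖tupleError P c ε k‖ := fun j =>
      (norm_sum_le _ _).trans (Finset.sum_le_sum fun k _ => by
        rw [norm_mul]
        exact mul_le_of_le_one_right (norm_nonneg _) (norm_walkWeight_le hf j k))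
    simpa using Finset.sum_le_card_nsmul Finset.univ _ _ fun j _ => hj j
  rw [norm_mul, norm_mul, norm_inv, Complex.norm_natCast, norm_pow, norm_inv, Complex.norm_real,
    Real.norm_of_nonneg hsq.le]
  calc _ ≤ (n : ℝ)⁻¹ * (√n)⁻¹ ^ q * (n * ∑ k : Fin q → Fin n, ‖tupleError P c ε k‖) := by
        gcongr
    _ = (√n * ∑ k : Fin q → Fin n, ‖tupleError P c ε k‖) * ((√n)⁻¹ ^ q * (√n)⁻¹) := by
        field_simp
    _ ≤ (errorCount (Fin q) * (1 + q * B + Fintype.card (Pairing ε)) * √n ^ q) *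
          ((√n)⁻¹ ^ q * (√n)⁻¹) := by
        gcongr
    _ = errorCount (Fin q) * (1 + q * B + Fintype.card (Pairing ε)) *
          (√n ^ q * (√n)⁻¹ ^ q) * (√n)⁻¹ := by ring
    _ = _ := by rw [← mul_pow, mul_inv_cancel₀ hsq.ne', one_pow, mul_one]

/-- The inputs may vary with `n`, since the twisting root does; the moment bounds must then be
uniform in `n` as well. -/
lemma tendsto_meanTrace_evalWord {c : ℕ → ℕ → Ω → ℂ} (hc : ∀ n, IsInputSequence P (c n)) (θ : ℝ)
    (hbdd : ∀ k : ℕ, ∃ B : ℝ, ∀ n j, ∫ ω, ‖c n j ω‖ ^ k ∂P ≤ B)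
    {q : ℕ} {ε : Fin q → Bool} {f : Fin (q + 1) → ℝ → ℂ} (hf : ∀ t, IsTame (f t))
    {w : List (Fin 2 × Bool)}
    (hw : ∀ (n : ℕ) (C : Matrix (Fin n) (Fin n) ℂ),
      evalWord ![C, diagFn n (expFn θ)] w = altProd n C ε f) :
    Tendsto (fun n : ℕ => meanTrace P n
      (evalWord ![((√n : ℝ) : ℂ)⁻¹ • circulantMat (hc n) n, diagMat P θ n] w)) atTop
      (𝓝 (altLimit ε f)) := by
  obtain ⟨B, hB⟩ := hbdd q
  have h0 : Tendsto (fun n : ℕ => errorCount (Fin q) *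
      (1 + q * B + Fintype.card (Pairing ε)) * (√(n : ℝ))⁻¹) atTop (𝓝 0) := by
    have := (tendsto_inv_atTop_zero.comp (Real.tendsto_sqrt_atTop.comp
      (tendsto_natCast_atTop_atTop (R := ℝ)))).const_mul
        (errorCount (Fin q) * (1 + q * B + Fintype.card (Pairing ε)))
    simpa [Function.comp_def] using this
  have hdiff := squeeze_zero_norm' (f := fun n : ℕ => meanTrace P n
    (evalWord ![((√n : ℝ) : ℂ)⁻¹ • circulantMat (hc n) n, diagMat P θ n] w) - pairingSum ε f n)
    (by
      filter_upwards [eventually_gt_atTop 0] with n hn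
      have : NeZero n := ⟨hn.ne'⟩
      exact norm_meanTrace_evalWord_sub_le (hc n) θ hf (hw n) (hB n)) h0
  simpa using hdiff.add (tendsto_pairingSum (ε := ε) hf)

lemma norm_twistRoot (n : ℕ) : ‖twistRoot n‖ = 1 := Complex.norm_exp_ofReal_mul_I _

omit [IsProbabilityMeasure P] in
lemma IsInputSequence.mul_pow (hc : IsInputSequence P c) {η : ℂ} (hη : ‖η‖ = 1) :
    IsInputSequence P fun j ω => c j ω * η ^ j where
  measurable j := (hc.measurable j).mul_const _
  indep := hc.indep.comp (fun j z => z * η ^ j) fun j => measurable_id.mul_const _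
  memLp j k := (hc.memLp j k).mul_const _
  mean j := by rw [integral_mul_const, hc.mean, zero_mul]
  variance j := by simpa [hη] using hc.variance j
  bounded k := by simpa [hη] using hc.bounded k

lemma tendsto_meanTrace_circulantMat (hc : IsInputSequence P c) (θ : ℝ)
    {q : ℕ} {ε : Fin q → Bool} {f : Fin (q + 1) → ℝ → ℂ} (hf : ∀ t, IsTame (f t))
    {w : List (Fin 2 × Bool)}
    (hw : ∀ (n : ℕ) (C : Matrix (Fin n) (Fin n) ℂ),
      evalWord ![C, diagFn n (expFn θ)] w = altProd n C ε f) :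
    Tendsto (fun n : ℕ => meanTrace P n
      (evalWord ![((√n : ℝ) : ℂ)⁻¹ • circulantMat hc n, diagMat P θ n] w)) atTop
      (𝓝 (altLimit ε f)) :=
  tendsto_meanTrace_evalWord (c := fun _ => c) (fun _ => hc) θ
    (fun k => (hc.bounded k).imp fun _ h _ => h) hf hw

lemma tendsto_meanTrace_twistedCirculantMat (hc : IsInputSequence P c) (θ : ℝ)
    {q : ℕ} {ε : Fin q → Bool} {f : Fin (q + 1) → ℝ → ℂ} (hf : ∀ t, IsTame (f t))
    {w : List (Fin 2 × Bool)}
    (hw : ∀ (n : ℕ) (C : Matrix (Fin n) (Fin n) ℂ),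
      evalWord ![C, diagFn n (expFn θ)] w = altProd n C ε f) :
    Tendsto (fun n : ℕ => meanTrace P n
      (evalWord ![((√n : ℝ) : ℂ)⁻¹ • twistedCirculantMat hc n, diagMat P θ n] w)) atTop
      (𝓝 (altLimit ε f)) :=
  tendsto_meanTrace_evalWord (fun n => hc.mul_pow (norm_twistRoot n)) θ
    (fun k => (hc.bounded k).imp fun B h n j => by simpa [norm_twistRoot] using h j) hf hw

end WordMoments

/-! ### Limits of words in the diagonal matrix -/

lemma isTame_evalWord {e : ℝ → ℂ} (he : IsTame e) (w : List (Unit × Bool)) :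
    IsTame fun u => evalWord (fun _ => e u) w := by
  induction w with
  | nil => exact isTame_one
  | cons p w ih =>
    simp only [evalWord_cons]
    exact (he.starIf p.2).mul ih

lemma continuous_evalWord (w : List (Unit × Bool)) :
    Continuous fun z : ℂ => evalWord (fun _ => z) w := by
  induction w with
  | nil => exact continuous_const
  | cons p w ih =>
    simp only [evalWord_cons]
    exact (continuous_starIf p.2).mul ih

lemma evalWord_diagFn (n : ℕ) (e : ℝ → ℂ) (w : List (Unit × Bool)) :
    evalWord (fun _ => diagFn n e) w = diagFn n fun u => evalWord (fun _ => e u) w := by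
  induction w with
  | nil => exact (diagFn_one n).symm
  | cons p w ih => simp only [evalWord_cons, ih, starIf_diagFn, diagFn_mul]

lemma tendsto_average {g : ℝ → ℂ} (hg : IsTame g) :
    Tendsto (fun n : ℕ => (n : ℂ)⁻¹ * ∑ j : Fin n, g (((j : ℕ) : ℝ) / n)) atTop
      (𝓝 (∫ u in Set.Ioo (0 : ℝ) 1, g u)) := by
  have h := tendsto_riemannSum (ι := Unit) (F := fun u => g (u ()))
    (hg.1.measurable.comp (measurable_pi_apply _)) (fun _ => hg.2 _)
    (ae_of_all _ fun u => (hg.1.comp (continuous_apply ())).continuousAt)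
  have hint : ∫ u in unitCube Unit, g (u ()) = ∫ u in Set.Ioo (0 : ℝ) 1, g u := by
    rw [← integral_Ico_eq_integral_Ioo,
      ← (volume_preserving_funUnique Unit ℝ).setIntegral_preimage_emb
        (MeasurableEquiv.measurableEmbedding _)]
    congr 2
    ext u
    simp only [unitCube, Set.mem_univ_pi, Set.mem_preimage]
    exact ⟨fun h => h (), fun h _ => h⟩
  rw [hint] at h
  refine h.congr fun n => ?_
  rw [Fintype.card_unit, pow_one]
  congr 1
  exact (Equiv.funUnique Unit (Fin n)).sum_comp fun j => g (((j : ℕ) : ℝ) / n)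

lemma tendsto_meanTrace_diagMat {Ω : Type*} [MeasurableSpace Ω] (P : Measure Ω)
    [IsProbabilityMeasure P] (θ : ℝ) (w : List (Unit × Bool)) :
    Tendsto (fun n => meanTrace P n (evalWord (fun _ => diagMat P θ n) w)) atTop
      (𝓝 (∫ z, evalWord (fun _ => z) w ∂expUniformLaw θ)) := by
  have hmeas : Measurable (expFn θ) := (isTame_expFn θ).1.measurable
  have hlaw : ∫ z, evalWord (fun _ => z) w ∂expUniformLaw θ =
      ∫ u in Set.Ioo (0 : ℝ) 1, evalWord (fun _ => expFn θ u) w :=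
    integral_map hmeas.aemeasurable (continuous_evalWord w).aestronglyMeasurable
  rw [hlaw]
  refine (tendsto_average (isTame_evalWord (isTame_expFn θ) w)).congr fun n => ?_
  change _ = (n : ℂ)⁻¹ * ∫ ω, _ ∂P
  simp only [evalWord_randMat_apply, diagMat_apply, evalWord_diagFn]
  simp [diagFn, Matrix.trace_diagonal]

/-! ### An input sequence -/

/-- The uniform law on `{1, -1}`. -/
def signLaw : Measure ℂ := (2⁻¹ : ENNReal) • (Measure.dirac 1 + Measure.dirac (-1))

instance : IsProbabilityMeasure signLaw := ⟨by
  simp [signLaw, ENNReal.inv_two_add_inv_two]⟩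

lemma ae_norm_signLaw : ∀ᵐ z ∂signLaw, ‖z‖ = 1 := by
  refine Measure.ae_smul_measure ?_ _
  rw [ae_add_measure_iff]
  constructor <;> rw [ae_dirac_iff (measurableSet_eq_fun measurable_norm measurable_const)] <;> simp

lemma integral_signLaw : ∫ z, z ∂signLaw = 0 := by
  rw [signLaw, integral_smul_measure, integral_add_measure (integrable_dirac (by simp))
    (integrable_dirac (by simp)), integral_dirac, integral_dirac]
  simp

/-- The limit space must exist before any model is given, so it is built from this one. For random
signs all absolute moments equal one. -/
lemma exists_isInputSequence : ∃ (Ω : Type) (_ : MeasurableSpace Ω) (P : Measure Ω)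
    (_ : IsProbabilityMeasure P) (c : ℕ → Ω → ℂ), IsInputSequence P c := by
  obtain ⟨Ω, _, P, c, hm, hlaw, hind, hP⟩ := exists_iid ℕ signLaw
  have hnorm : ∀ j, ∀ᵐ ω ∂P, ‖c j ω‖ = 1 := fun j =>
    ae_of_ae_map (hm j).aemeasurable ((hlaw j).map_eq.symm ▸ ae_norm_signLaw)
  have hpow : ∀ j k, ∫ ω, ‖c j ω‖ ^ k ∂P = 1 := fun j k => by
    rw [integral_congr_ae (g := fun _ => (1 : ℝ)) (by
      filter_upwards [hnorm j] with ω hω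
      rw [hω, one_pow])]
    simp
  refine ⟨Ω, _, P, hP, c, hm, hind, fun j k => ?_, fun j => ?_, fun j => hpow j 2,
    fun k => ⟨1, fun j => (hpow j k).le⟩⟩
  · exact MemLp.of_bound (hm j).aestronglyMeasurable 1 ((hnorm j).mono fun ω h => h.le)
  · have := integral_map (μ := P) (hm j).aemeasurable (f := fun z : ℂ => z)
      aestronglyMeasurable_id
    rw [← this, (hlaw j).map_eq, integral_signLaw]

/-! ### The limit algebra -/

section LimitAlgebra

variable {ι : Type*} {A : ℕ → Type*} [∀ n, Ring (A n)] [∀ n, StarRing (A n)]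
  [∀ n, Algebra ℂ (A n)] [∀ n, StarModule ℂ (A n)]

lemma evalWord_append {B : Type*} [Monoid B] [Star B] (a : ι → B) (w w' : List (ι × Bool)) :
    evalWord a (w ++ w') = evalWord a w * evalWord a w' := by
  simp [evalWord]

lemma mem_span_evalWord_of_mem_adjoin {B : Type*} [Ring B] [StarRing B] [Algebra ℂ B]
    [StarModule ℂ B] (a : ι → B) {x : B} (hx : x ∈ StarAlgebra.adjoin ℂ (Set.range a)) :
    x ∈ Submodule.span ℂ (Set.range (evalWord a)) := by
  rw [← StarSubalgebra.mem_toSubalgebra, ← Subalgebra.mem_toSubmodule,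
    StarAlgebra.adjoin_eq_span] at hx
  refine Submodule.span_mono (fun y hy => ?_) hx
  induction hy using Submonoid.closure_induction with
  | one => exact ⟨[], rfl⟩
  | mul y z _ _ hy hz =>
    obtain ⟨w, rfl⟩ := hy
    obtain ⟨w', rfl⟩ := hz
    exact ⟨w ++ w', evalWord_append a w w'⟩
  | mem y hy =>
    rcases hy with ⟨i, rfl⟩ | ⟨i, hi⟩
    · exact ⟨[(i, false)], by simp [evalWord]⟩
    · exact ⟨[(i, true)], by simp [evalWord, hi]⟩

/-- The star algebra of sequences generated by a family of sequences. -/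
abbrev seqAlgebra (a : ∀ n, ι → A n) : StarSubalgebra ℂ (∀ n, A n) :=
  StarAlgebra.adjoin ℂ (Set.range fun i n => a n i)

/-- A member of the generating family of `seqAlgebra a`. -/
def seqGen (a : ∀ n, ι → A n) (i : ι) : seqAlgebra a :=
  ⟨fun n => a n i, StarAlgebra.subset_adjoin _ _ ⟨i, rfl⟩⟩

lemma evalWord_seqGen_comp_apply {κ : Type*} (a : ∀ n, ι → A n) (g : κ → ι)
    (w : List (κ × Bool)) (n : ℕ) :
    (evalWord (fun k => seqGen a (g k)) w).1 n = evalWord (fun k => a n (g k)) w := by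
  induction w with
  | nil => simp [evalWord]
  | cons p w ih =>
    rw [evalWord_cons, evalWord_cons, ← ih]
    unfold starIf
    split_ifs <;> rfl

lemma evalWord_seqGen_apply (a : ∀ n, ι → A n) (w : List (ι × Bool)) (n : ℕ) :
    (evalWord (seqGen a) w).1 n = evalWord (a n) w :=
  evalWord_seqGen_comp_apply a id w n

/-- Words in the generators span the generated star algebra, and convergence is preserved under
linear combinations. -/
lemma exists_tendsto_of_mem_seqAlgebra {φ : ∀ n, A n →ₗ[ℂ] ℂ} {a : ∀ n, ι → A n}
    (h : ∀ w, ∃ l, Tendsto (fun n => φ n (evalWord (a n) w)) atTop (𝓝 l))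
    (x : seqAlgebra a) : ∃ l, Tendsto (fun n => φ n (x.1 n)) atTop (𝓝 l) := by
  suffices hs : ∀ y : ∀ n, A n, y ∈ Submodule.span ℂ (Set.range (evalWord fun i n => a n i)) →
      ∃ l, Tendsto (fun n => φ n (y n)) atTop (𝓝 l) from
    hs x.1 (mem_span_evalWord_of_mem_adjoin _ x.2)
  intro y hy
  induction hy using Submodule.span_induction with
  | mem y hy =>
    obtain ⟨w, rfl⟩ := hy
    obtain ⟨l, hl⟩ := h w
    refine ⟨l, hl.congr fun n => ?_⟩
    rw [← evalWord_seqGen_apply a w n]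
    congr 1
    have := evalWord_map (seqAlgebra a).subtype (seqGen a) w
    exact congrFun this n
  | zero => exact ⟨0, by simp⟩
  | add y z _ _ hy hz =>
    obtain ⟨l, hl⟩ := hy
    obtain ⟨m, hm⟩ := hz
    exact ⟨l + m, by simpa using hl.add hm⟩
  | smul r y _ hy =>
    obtain ⟨l, hl⟩ := hy
    exact ⟨r * l, by simpa using hl.const_mul r⟩

/-- The limit functional on `seqAlgebra a`. -/
def limFunctional {φ : ∀ n, A n →ₗ[ℂ] ℂ} {a : ∀ n, ι → A n}
    (h : ∀ w, ∃ l, Tendsto (fun n => φ n (evalWord (a n) w)) atTop (𝓝 l)) :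
    seqAlgebra a →ₗ[ℂ] ℂ where
  toFun x := (exists_tendsto_of_mem_seqAlgebra h x).choose
  map_add' x y := by
    have h' := (exists_tendsto_of_mem_seqAlgebra h x).choose_spec.add
      (exists_tendsto_of_mem_seqAlgebra h y).choose_spec
    exact tendsto_nhds_unique (exists_tendsto_of_mem_seqAlgebra h (x + y)).choose_spec
      (by simpa using h')
  map_smul' r x := tendsto_nhds_unique (exists_tendsto_of_mem_seqAlgebra h (r • x)).choose_spec
    (by simpa using (exists_tendsto_of_mem_seqAlgebra h x).choose_spec.const_mul r)

lemma limFunctional_eq {φ : ∀ n, A n →ₗ[ℂ] ℂ} {a : ∀ n, ι → A n}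
    (h : ∀ w, ∃ l, Tendsto (fun n => φ n (evalWord (a n) w)) atTop (𝓝 l))
    {x : seqAlgebra a} {l : ℂ} (hl : Tendsto (fun n => φ n (x.1 n)) atTop (𝓝 l)) :
    limFunctional h x = l :=
  tendsto_nhds_unique (exists_tendsto_of_mem_seqAlgebra h x).choose_spec hl

end LimitAlgebra

/-- The normalised circulant matrix and the diagonal matrix. -/
def circDiagPair {Ω : Type*} [MeasurableSpace Ω] {P : Measure Ω} [IsProbabilityMeasure P]
    {c : ℕ → Ω → ℂ} (hc : IsInputSequence P c) (θ : ℝ) (n : ℕ) : Fin 2 → randMat P n :=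
  ![((√n : ℝ) : ℂ)⁻¹ • circulantMat hc n, diagMat P θ n]

/-! ### Normality and moments of the limit -/

lemma circ_mul_comm {n : ℕ} (v w : Fin n → ℂ) : circ v * circ w = circ w * circ v := by
  have h : ∀ v : Fin n → ℂ, circ v = (Matrix.circulant v).transpose := fun v => rfl
  rw [h, h, Matrix.Fin.transpose_circulant, Matrix.Fin.transpose_circulant,
    Matrix.Fin.circulant_mul_comm]

lemma star_circ {n : ℕ} (v : Fin n → ℂ) : star (circ v) = circ fun k => star (v (-k)) := by
  have h : ∀ v : Fin n → ℂ, circ v = (Matrix.circulant v).transpose := fun v => rfl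
  rw [h, h, Matrix.star_eq_conjTranspose, Matrix.Fin.transpose_circulant,
    Matrix.Fin.transpose_circulant, Matrix.Fin.conjTranspose_circulant]
  rfl

/-- The adjoint of a circulant is a circulant, and circulants commute. Normality thus holds at every
`n`, as an identity in the algebra and not merely in moments. -/
lemma isStarNormal_seqGen_circDiagPair {Ω : Type*} [MeasurableSpace Ω] {P : Measure Ω}
    [IsProbabilityMeasure P] {c : ℕ → Ω → ℂ} (hc : IsInputSequence P c) (θ : ℝ) :
    IsStarNormal (seqGen (circDiagPair hc θ) 0) := by
  refine ⟨Subtype.ext (funext fun n => Subtype.ext (funext fun ω => ?_))⟩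
  have hN : (circDiagPair hc θ n 0).1 ω = circ fun k : Fin n => ((√n : ℝ) : ℂ)⁻¹ * c k ω :=
    (circ_smul _ _).symm
  change star ((circDiagPair hc θ n 0).1 ω) * (circDiagPair hc θ n 0).1 ω =
    (circDiagPair hc θ n 0).1 ω * star ((circDiagPair hc θ n 0).1 ω)
  rw [hN, star_circ, circ_mul_comm]

lemma card_pairing {q k l : ℕ} {ε : Fin q → Bool} (hk : Fintype.card {s // ε s = false} = k)
    (hl : Fintype.card {s // ε s = true} = l) :
    Fintype.card (Pairing ε) = if k = l then k.factorial else 0 := by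
  split_ifs with h
  · rw [Fintype.card_equiv (Fintype.equivOfCardEq (hk.trans (h.trans hl.symm))), hk]
  · rw [Fintype.card_eq_zero_iff]
    exact ⟨fun τ => h (hk.symm.trans ((Fintype.card_congr τ).trans hl))⟩

/-- The word `x ^ k * star x ^ l` in the first letter. -/
def normalWord (k l : ℕ) : List (Fin 2 × Bool) :=
  List.replicate k (0, false) ++ List.replicate l (0, true)

lemma evalWord_normalWord {A : Type*} [Monoid A] [Star A] (a : Fin 2 → A) (k l : ℕ) :
    evalWord a (normalWord k l) = a 0 ^ k * star (a 0) ^ l := by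
  simp [normalWord, evalWord]

lemma fst_eq_zero_of_mem_normalWord {k l : ℕ} {p : Fin 2 × Bool} (hp : p ∈ normalWord k l) :
    p.1 = 0 := by
  rw [normalWord, List.mem_append, List.mem_replicate, List.mem_replicate] at hp
  rcases hp with ⟨-, rfl⟩ | ⟨-, rfl⟩ <;> rfl

/-- Every pairing contributes one, and there are `k!` bijections if `k = l` and none otherwise. -/
lemma altLimit_normalWord {k l q : ℕ} {ε : Fin q → Bool} {f : Fin (q + 1) → ℝ → ℂ}
    (hcount : ∀ b, Fintype.card {s // ε s = b} = (normalWord k l).count (0, b))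
    (hone : ∀ t, f t = fun _ => 1) :
    altLimit ε f = ∫ z, z ^ k * star z ^ l ∂stdComplexGaussian := by
  rw [altLimit_one hone, stdComplexGaussian_moments, card_pairing (k := k) (l := l)
    (by rw [hcount, normalWord]; simp [List.count_append, List.count_replicate])
    (by rw [hcount, normalWord]; simp [List.count_append, List.count_replicate])]
  push_cast
  rfl

/-- Self-adjointness would identify `φ (a * star a) = 1` with `φ (a ^ 2) = 0`. -/
lemma not_isSelfAdjoint_of_moments {A : Type*} [Ring A] [StarRing A] [Algebra ℂ A]
    {φ : A →ₗ[ℂ] ℂ} {a : A}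
    (h : ∀ k l : ℕ, φ (a ^ k * star a ^ l) = ∫ z, z ^ k * star z ^ l ∂stdComplexGaussian) :
    ¬ IsSelfAdjoint a := by
  intro ha
  have h1 := h 1 1
  have h2 := h 2 0
  rw [stdComplexGaussian_moments] at h1 h2
  rw [ha.star_eq] at h1 h2
  rw [pow_one, ← sq] at h1
  rw [pow_zero, mul_one, h1] at h2
  simp at h2

end CirculantStarConv

end

/-! ### The joint limit -/

open CirculantStarConv in
theorem mainTheorem12 (θ : ℝ) (hθ : θ ∈ Set.Icc (-Real.pi) Real.pi) :
    ∃ (A : Type) (_ : Ring A) (_ : StarRing A) (_ : Algebra ℂ A) (_ : StarModule ℂ A)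
      (φ : A →ₗ[ℂ] ℂ) (N d : A),
      φ 1 = 1 ∧
      IsStdComplexGaussian φ N ∧
      HasStarMomentsOf φ d (expUniformLaw θ) ∧
      ∀ (Ω : Type*) [MeasurableSpace Ω] (P : Measure Ω) [IsProbabilityMeasure P]
        (c : ℕ → Ω → ℂ) (hc : IsInputSequence P c),
        StarConverges (meanTrace P)
          (fun n => ![((Real.sqrt n : ℝ) : ℂ)⁻¹ • circulantMat hc n, diagMat P θ n])
          φ ![N, d] ∧
        StarConverges (meanTrace P)
          (fun n => ![((Real.sqrt n : ℝ) : ℂ)⁻¹ • twistedCirculantMat hc n, diagMat P θ n])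
          φ ![N, d] := by
  -- The data of each word are fixed once, before any model, so every model converges to the same
  -- `altLimit`.
  choose q ε f hf hcount hone heval using exists_altProd (isTame_expFn θ)
  obtain ⟨Ω₀, _, P₀, _, c₀, hc₀⟩ := exists_isInputSequence
  have hlim : ∀ w, Tendsto (fun n => meanTrace P₀ n (evalWord (circDiagPair hc₀ θ n) w)) atTop
      (𝓝 (altLimit (ε w) (f w))) :=
    fun w => tendsto_meanTrace_circulantMat hc₀ θ (hf w) (heval w)
  have hex : ∀ w, ∃ l, Tendsto (fun n => meanTrace P₀ n (evalWord (circDiagPair hc₀ θ n) w))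
      atTop (𝓝 l) := fun w => ⟨_, hlim w⟩
  have hφ : ∀ w, limFunctional hex (evalWord (seqGen (circDiagPair hc₀ θ)) w) =
      altLimit (ε w) (f w) := fun w =>
    limFunctional_eq hex (by simpa only [evalWord_seqGen_apply] using hlim w)
  have hgen : ![seqGen (circDiagPair hc₀ θ) 0, seqGen (circDiagPair hc₀ θ) 1] =
      seqGen (circDiagPair hc₀ θ) := by
    funext i
    fin_cases i <;> rfl
  have hmom : ∀ k l : ℕ, limFunctional hex
      (seqGen (circDiagPair hc₀ θ) 0 ^ k * star (seqGen (circDiagPair hc₀ θ) 0) ^ l) =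
      ∫ z, z ^ k * star z ^ l ∂stdComplexGaussian := fun k l => by
    rw [← evalWord_normalWord, hφ]
    exact altLimit_normalWord (hcount _) (hone _ fun p hp => fst_eq_zero_of_mem_normalWord hp)
  refine ⟨seqAlgebra (circDiagPair hc₀ θ), inferInstance, inferInstance, inferInstance,
    inferInstance, limFunctional hex, seqGen _ 0, seqGen _ 1, ?_,
    ⟨isStarNormal_seqGen_circDiagPair hc₀ θ, not_isSelfAdjoint_of_moments hmom, hmom⟩,
    fun w => ?_, fun Ω _ P _ c hc => ⟨fun w => ?_, fun w => ?_⟩⟩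
  · refine limFunctional_eq hex (tendsto_const_nhds.congr' ?_)
    -- In dimension zero the normalised trace of the unit is `0`, so this holds only eventually.
    filter_upwards [eventually_gt_atTop 0] with n hn
    exact (meanTrace_one P₀ n hn.ne').symm
  · refine limFunctional_eq hex ((tendsto_meanTrace_diagMat P₀ θ w).congr fun n => ?_)
    exact congrArg _
      (evalWord_seqGen_comp_apply (circDiagPair hc₀ θ) (fun _ : Unit => 1) w n).symm
  · rw [hgen, hφ]
    exact tendsto_meanTrace_circulantMat hc θ (hf w) (heval w)
  · rw [hgen, hφ]
    exact tendsto_meanTrace_twistedCirculantMat hc θ (hf w) (heval w)
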